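/- Setting. Let $T=[0,\infty)$, let $Q$ be a finite set (of discrete modes), $Q^*$ the words over $Q$, $Q^{\le L}$ the words of length at most $L$, $\epsilon$ the empty word, $\mathcal U=\mathbb R^m$, $\mathcal Y=\mathbb R^p$. Let $PC(T,\mathcal U)$ be the piecewise-continuous maps $T\to\mathcal U$ (finitely many discontinuities on every $[0,t]$, with finite one-sided limits), and $(Q\times T)^+$ the non-empty finite sequences $(q_1,t_1)\cdots(q_k,t_k)$. An input-output map is a map $f:PC(T,\mathcal U)\times(Q\times T)^+\to\mathcal Y$; let $\Phi$ be a non-empty (possibly infinite) set of such maps. A linear switched system (LSS) $\Sigma$ of dimension $n\ge 0$ consists of matrices $A_q\in\mathbb R^{n\times n}$, $B_q\in\mathbb R^{n\times m}$, $C_q\in\mathbb R^{p\times n}$, $q\in Q$. The state $x_\Sigma(x_0,u,w)$, $w=(q_1,t_1)\cdots(q_k,t_k)$, is obtained from $x_0$ by following $\dot x(s)=A_{q_i}x(s)+B_{q_i}u(s+\sum_{j<i}t_j)$ for time $t_i$, successively for $i=1,\dots,k$, and $y_\Sigma(x_0,u,w)=C_{q_k}x_\Sigma(x_0,u,w)$.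 An LSS realization is a pair $(\Sigma,\mu)$ with $\mu:\Phi\to\mathbb R^n$. It is a realization of $\Phi$ if $y_\Sigma(\mu(f),u,w)=f(u,w)$ for all $f\in\Phi$, $u$, $w$; a minimal one if moreover no realization of $\Phi$ has smaller dimension; semi-reachable if the states $x_\Sigma(\mu(f),u,w)$ ($f\in\Phi$, $u\in PC(T,\mathcal U)$, $w\in(Q\times T)^+$) span $\mathbb R^n$; observable if distinct states $x_1\ne x_2$ always have $y_\Sigma(x_1,\cdot,\cdot)\neq y_\Sigma(x_2,\cdot,\cdot)$. $\Phi$ has a generalized kernel representation if there are analytic functions $K^f_w:T^{|w|}\to\mathbb R^p$ and $G_w:T^{|w|}\to\mathbb R^{p\times m}$ ($f\in\Phi$, $w$ a non-empty word) such that (i) $K^f_{wqqv}(\dots,t,\hat t,\dots)=K^f_{wqv}(\dots,t+\hat t,\dots)$ and likewise for $G$; (ii) $K^f_{vqw}(\dots,0,\dots)=K^f_{vw}(\dots)$ whenever $w\ne\epsilon$ (with $0$ in the place of $q$), and likewise for $G$ whenever $v,w\neq\epsilon$; (iii) $f(u,(q_1,t_1)\cdots(q_k,t_k))=K^f_{q_1\cdots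 q_k}(t_1,\dots,t_k)+\sum_{i=1}^k\int_0^{t_i}G_{q_i\cdots q_k}(t_i-s,t_{i+1},\dots,t_k)\,u(s+\sum_{j<i}t_j)\,ds$. The Markov parameters of such a $\Phi$ are, for $w=q_1\cdots q_k$, $k\ge 0$, with $f_{u,q_1\cdots q_k}(t_1,\dots,t_k)=f(u,(q_1,t_1)\cdots(q_k,t_k))$, \[S_{f,q}(w)=\tfrac{d}{dt_1}\cdots\tfrac{d}{dt_k}f_{0,q_1\cdots q_kq}(t_1,\dots,t_k,0)\big|_{0},\] \[S_{q,q_0,j}(w)=\tfrac{d}{dt_0}\cdots\tfrac{d}{dt_k}\bigl(f_{e_j,q_0q_1\cdots q_kq}-f_{0,q_0q_1\cdots q_kq}\bigr)(t_0,\dots,t_k,0)\big|_{0},\] where $e_j$ is the constant input equal to the $j$-th unit vector, and the second expression does not depend on $f\in\Phi$. $(\Sigma,\mu)$ is an $N$-partial realization of $\Phi$ if $S_{q,q_0,j}(q_1\cdots q_k)=C_qA_{q_k}\cdots A_{q_1}B_{q_0}e_j$ and $S_{f,q}(q_1\cdots q_k)=C_qA_{q_k}\cdots A_{q_1}\mu(f)$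 for all words of length $k\le N$ and all $q,q_0\in Q$, $1\le j\le m$, $f\in\Phi$. The Hankel matrix $H_\Phi$ has rows indexed by $(v,(q,r))\in Q^*\times(Q\times\{1,\dots,p\})$, columns indexed by $(w,j)$ with $w\in Q^*$ and $j\in J_\Phi=\Phi\sqcup(Q\times\{1,\dots,m\})$, and entries $(S_{f,q}(wv))_r$ if $j=f\in\Phi$ and $(S_{q,q_0,z}(wv))_r$ if $j=(q_0,z)$. $H_{\Phi,L,M}$ is the submatrix of rows with $|v|\le L$ and columns with $|w|\le M$. The rank (in $\mathbb N\cup\{\infty\}$) of a matrix is the dimension of the span of its columns. Algorithm 1, for $N\in\mathbb N$: let $n=\operatorname{rank}H_{\Phi,N,N+1}$, let $\mathcal M$ be a linear isomorphism from the column space of $H_{\Phi,N,N+1}$ to $\mathbb R^n$, and let $c_{w,j}$ be the columns of $H_{\Phi,N,N+1}$. Return $(\Sigma_N,\mu_N)$ of dimension $n$ such that, for all $q\in Q$: the $z$-th column of $B_q$ is $\mathcal M(c_{\epsilon,(q,z)})$; $C_q\mathcal M(c_{w,j})$ is the vector of the entries of $c_{w,j}$ in the rows $(\epsilon,(q,1)),\dots,(\epsilon,(q,p))$,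 for all $w\in Q^{\le N+1}$, $j\in J_\Phi$; $\mathcal M^{-1}A_q\mathcal M(c_{w,j})=c_{wq,j}$ for all $w\in Q^{\le N}$, $j\in J_\Phi$ (abort if there is no such $A_q$); and $\mu_N(f)=\mathcal M(c_{\epsilon,f})$ for $f\in\Phi$. Theorem. Let $\Phi$ be a non-empty family of input-output maps admitting a generalized kernel representation, and let $N\in\mathbb N$. 1. If \[\operatorname{rank}H_{\Phi,N,N}=\operatorname{rank}H_{\Phi,N+1,N}=\operatorname{rank}H_{\Phi,N,N+1},\tag{$*$}\] then, for every choice of $\mathcal M$, Algorithm 1 returns a (uniquely determined) realization $(\Sigma_N,\mu_N)$, and it is a semi-reachable and observable $(2N+1)$-partial realization of $\Phi$. 2. If $\operatorname{rank}H_{\Phi,N,N}=\operatorname{rank}H_\Phi$, then $(*)$ holds and $(\Sigma_N,\mu_N)$ is a minimal realization of $\Phi$. 3. If $\Phi$ has an LSS realization $(\Sigma,\mu)$ with $\dim\Sigma\le N+1$, then $\operatorname{rank}H_{\Phi,N,N}=\operatorname{rank}H_\Phi$. -/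

import Mathlib

open Set Filter Topology MeasureTheory
open scoped NNReal Matrix

noncomputable section

namespace SwitchedSystem

/-! The time axis `T = [0, ∞)` is `ℝ≥0`; the spaces `ℝⁿ` are `Fin n → ℝ`; `Q` is the set of
discrete modes, words over `Q` are `List Q`. -/

/-- Piecewise-continuous maps `T → ℝᵐ`: finitely many discontinuities on each `[0, t]`, and finite
one-sided limits at each of them. (At `s = 0` the left-hand condition is void, as `𝓝[<] 0 = ⊥`.) -/
def IsPiecewiseContinuous {m : ℕ} (u : ℝ≥0 → Fin m → ℝ) : Prop :=
  (∀ t : ℝ≥0, {s | s ≤ t ∧ ¬ ContinuousAt u s}.Finite) ∧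
  ∀ s, ¬ ContinuousAt u s →
    (∃ l, Tendsto u (𝓝[>] s) (𝓝 l)) ∧ (∃ l, Tendsto u (𝓝[<] s) (𝓝 l))

/-- The space `PC(T, ℝᵐ)` of continuous-valued inputs. -/
def PC (m : ℕ) : Type := {u : ℝ≥0 → Fin m → ℝ // IsPiecewiseContinuous u}

/-- The constant input with value `a`. -/
def PC.const {m : ℕ} (a : Fin m → ℝ) : PC m :=
  ⟨fun _ => a, by
    have h : ∀ s : ℝ≥0, ContinuousAt (fun _ : ℝ≥0 => a) s := fun s => continuousAt_const
    refine ⟨fun t => ?_, fun s hs => absurd (h s) hs⟩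
    simp [h]⟩

/-- The set `(Q × T)⁺` of non-empty switching sequences `(q₁,t₁)⋯(q_k,t_k)`. -/
abbrev SwitchSeq (Q : Type*) : Type _ := {w : List (Q × ℝ≥0) // w ≠ []}

/-- Input-output maps `PC(T, ℝᵐ) × (Q × T)⁺ → ℝᵖ`. -/
abbrev IOMap (Q : Type*) (m p : ℕ) : Type _ := PC m → SwitchSeq Q → Fin p → ℝ

/-! ### Linear switched systems -/

/-- A linear switched system `ẋ = A_q x + B_q u`, `y = C_q x` with state space `ℝⁿ`. -/
structure LSS (Q : Type*) (m p n : ℕ) where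
  A : Q → Matrix (Fin n) (Fin n) ℝ
  B : Q → Matrix (Fin n) (Fin m) ℝ
  C : Q → Matrix (Fin p) (Fin n) ℝ

/-- `x` solves `ẋ(s) = A x(s) + B v(s)` on `[0, ∞)` with `x(0) = x₀`: it is continuous and
satisfies the equation wherever the (piecewise-continuous) input `v` is continuous. -/
def IsSolution {n m : ℕ} (A : Matrix (Fin n) (Fin n) ℝ) (B : Matrix (Fin n) (Fin m) ℝ)
    (v : ℝ → Fin m → ℝ) (x₀ : Fin n → ℝ) (x : ℝ → Fin n → ℝ) : Prop :=
  ContinuousOn x (Ici 0) ∧ x 0 = x₀ ∧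
    ∀ s : ℝ, 0 < s → ContinuousAt v s → HasDerivAt x (A *ᵥ x s + B *ᵥ v s) s

/-- The solution of the initial value problem (on `[0, ∞)` it exists and is unique for every
piecewise-continuous `v`). -/
def solution {n m : ℕ} (A : Matrix (Fin n) (Fin n) ℝ) (B : Matrix (Fin n) (Fin m) ℝ)
    (v : ℝ → Fin m → ℝ) (x₀ : Fin n → ℝ) : ℝ → Fin n → ℝ :=
  Classical.epsilon (IsSolution A B v x₀)

namespace LSS

variable {Q : Type*} {m p n : ℕ}

/-- The state reached from `x₀`, started at time `τ` with the input `u`, after running through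
the given sequence of modes and dwell times. -/
def stateFrom (S : LSS Q m p n) (u : PC m) :
    ℝ≥0 → (Fin n → ℝ) → List (Q × ℝ≥0) → Fin n → ℝ
  | _, x₀, [] => x₀
  | τ, x₀, (q, t) :: w =>
      S.stateFrom u (τ + t)
        (solution (S.A q) (S.B q) (fun s => u.1 (s.toNNReal + τ)) x₀ (t : ℝ)) w

/-- The state `x_Σ(x₀, u, w)`. -/
def state (S : LSS Q m p n) (x₀ : Fin n → ℝ) (u : PC m) (w : SwitchSeq Q) : Fin n → ℝ :=
  S.stateFrom u 0 x₀ w.1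

/-- The output `y_Σ(x₀, u, w) = C_{q_k} x_Σ(x₀, u, w)`; as a function of `(u, w)` this is the
input-output map induced by `x₀`. -/
def output (S : LSS Q m p n) (x₀ : Fin n → ℝ) : IOMap Q m p :=
  fun u w => S.C (w.1.getLast w.2).1 *ᵥ S.state x₀ u w

/-- The set of states reachable from `X₀`. -/
def Reach (S : LSS Q m p n) (X₀ : Set (Fin n → ℝ)) : Set (Fin n → ℝ) :=
  {x | ∃ u : PC m, ∃ w : SwitchSeq Q, ∃ x₀ ∈ X₀, x = S.state x₀ u w}

/-- `S` is semi-reachable from `X₀`: the reachable set spans the state space. -/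
def SemiReachableFrom (S : LSS Q m p n) (X₀ : Set (Fin n → ℝ)) : Prop :=
  Submodule.span ℝ (S.Reach X₀) = ⊤

/-- `S` is observable: no two distinct states induce the same input-output map. -/
def Observable (S : LSS Q m p n) : Prop :=
  ∀ x₁ x₂ : Fin n → ℝ, (∀ u w, S.output x₁ u w = S.output x₂ u w) → x₁ = x₂

/-- `A_{q_k} ⋯ A_{q_1} x` for the word `q_1 ⋯ q_k`. -/
def runWord (S : LSS Q m p n) (w : List Q) (x : Fin n → ℝ) : Fin n → ℝ :=
  w.foldl (fun y q => S.A q *ᵥ y) x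

end LSS

/-- An LSS realization `(Σ, μ)` of dimension `n`, with `μ` assigning a state to each `f ∈ Φ`. -/
structure Realization {Q : Type*} {m p : ℕ} (Φ : Set (IOMap Q m p)) (n : ℕ) where
  sys : LSS Q m p n
  μ : Φ → Fin n → ℝ

/-! ### Markov parameters -/

section Markov

variable {Q : Type*} {m p : ℕ}

/-- For `w = q₁⋯q_k`, the iterated partial derivative
`d/dt₁ ⋯ d/dt_k g((q₁,t₁)⋯(q_k,t_k))` at `t₁ = ⋯ = t_k = 0`. The functions live on `T^k`, so
the derivatives are one-sided. -/
def mixedDeriv : (List (Q × ℝ≥0) → Fin p → ℝ) → List Q → Fin p → ℝ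
  | g, [] => g []
  | g, q :: w =>
      derivWithin (fun t : ℝ => mixedDeriv (fun l => g ((q, t.toNNReal) :: l)) w) (Ici 0) 0

/-- `d/dt₁ ⋯ d/dt_k f_{u, q₁⋯q_k q}(t₁, …, t_k, 0)` at `t₁ = ⋯ = t_k = 0`. -/
def ioDeriv (f : IOMap Q m p) (u : PC m) (w : List Q) (q : Q) : Fin p → ℝ :=
  mixedDeriv (fun l => f u ⟨l ++ [(q, 0)], by simp⟩) w

/-- The Markov parameter `S_{f,q}(w)`. -/
def markovState (f : IOMap Q m p) (q : Q) (w : List Q) : Fin p → ℝ :=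
  ioDeriv f (PC.const 0) w q

/-- The Markov parameter `S_{q,q₀,j}(w)`, computed from the member `f` of the family. For a family
with a generalized kernel representation it does not depend on the member. -/
def markovInput (f : IOMap Q m p) (q q₀ : Q) (j : Fin m) (w : List Q) : Fin p → ℝ :=
  ioDeriv f (PC.const (Pi.single j 1)) (q₀ :: w) q - ioDeriv f (PC.const 0) (q₀ :: w) q

end Markov

/-! ### Generalized kernel representations -/

/-- A function of switching sequences is analytic if for each word `q₁⋯q_k` it is an analytic
function of `(t₁, …, t_k)` on `T^k`. -/
def AnalyticInTimes {Q E : Type*} [NormedAddCommGroup E] [NormedSpace ℝ E]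
    (F : List (Q × ℝ≥0) → E) : Prop :=
  ∀ (k : ℕ) (q : Fin k → Q),
    AnalyticOn ℝ (fun t : Fin k → ℝ => F (List.ofFn fun i => (q i, (t i).toNNReal)))
      {t | ∀ i, 0 ≤ t i}

/-- `Φ` has a generalized kernel representation. The value `K_{q₁⋯q_k}(t₁,…,t_k)` is written
`K [(q₁,t₁),…,(q_k,t_k)]`, and similarly for `G`; values at the empty list play no role. -/
def HasGeneralizedKernelRepresentation {Q : Type*} {m p : ℕ} (Φ : Set (IOMap Q m p)) : Prop :=
  ∃ (K : Φ → List (Q × ℝ≥0) → Fin p → ℝ) (G : List (Q × ℝ≥0) → Matrix (Fin p) (Fin m) ℝ),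
    ((∀ f, AnalyticInTimes (K f)) ∧ ∀ i j, AnalyticInTimes (fun l => G l i j)) ∧
    (∀ (w v : List (Q × ℝ≥0)) (q : Q) (t t' : ℝ≥0),
      (∀ f, K f (w ++ (q, t) :: (q, t') :: v) = K f (w ++ (q, t + t') :: v)) ∧
      G (w ++ (q, t) :: (q, t') :: v) = G (w ++ (q, t + t') :: v)) ∧
    (∀ (v w : List (Q × ℝ≥0)) (q : Q), w ≠ [] →
      (∀ f, K f (v ++ (q, 0) :: w) = K f (v ++ w)) ∧
      (v ≠ [] → G (v ++ (q, 0) :: w) = G (v ++ w))) ∧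
    ∀ (f : Φ) (u : PC m) (w : SwitchSeq Q),
      f.1 u w = K f w.1 + ∑ i : Fin w.1.length,
        ∫ s in (0 : ℝ)..((w.1.get i).2 : ℝ),
          G (((w.1.get i).1, (((w.1.get i).2 : ℝ) - s).toNNReal) :: w.1.drop (i + 1)) *ᵥ
            u.1 (s.toNNReal + ((w.1.take i).map Prod.snd).sum)

/-! ### Hankel matrices -/

section Hankel

variable {Q : Type*} {m p : ℕ}

/-- The Hankel matrix `H_Φ`. Rows are indexed by `(v, (q, r))`, the pair `(q, r)` standing for
the `r`-th coordinate of the block belonging to the mode `q`; columns are indexed by `(w, j)`,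
`j ∈ Φ ∪ (Q × {1,…,m})`. The member `f₀` of `Φ` serves to compute the `S_{q,q₀,j}`. -/
def hankel (Φ : Set (IOMap Q m p)) (f₀ : Φ) :
    Matrix (List Q × (Q × Fin p)) (List Q × (Φ ⊕ (Q × Fin m))) ℝ :=
  fun vi wj =>
    match wj.2 with
    | Sum.inl f => markovState f.1 vi.2.1 (wj.1 ++ vi.1) vi.2.2
    | Sum.inr qz => markovInput f₀.1 vi.2.1 qz.1 qz.2 (wj.1 ++ vi.1) vi.2.2

/-- The words of length at most `L`. -/
abbrev WordLE (Q : Type*) (L : ℕ) : Type _ := {w : List Q // w.length ≤ L}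

/-- The submatrix `H_{Φ,L,M}`: rows with `|v| ≤ L`, columns with `|w| ≤ M`. -/
def subHankel (Φ : Set (IOMap Q m p)) (f₀ : Φ) (L M : ℕ) :
    Matrix (WordLE Q L × (Q × Fin p)) (WordLE Q M × (Φ ⊕ (Q × Fin m))) ℝ :=
  (hankel Φ f₀).submatrix (Prod.map Subtype.val id) (Prod.map Subtype.val id)

/-- The condition `rank H_{Φ,N,N} = rank H_{Φ,N+1,N} = rank H_{Φ,N,N+1}`. -/
def RankCondition (Φ : Set (IOMap Q m p)) (f₀ : Φ) (N : ℕ) : Prop :=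
  (subHankel Φ f₀ N N).eRank = (subHankel Φ f₀ (N + 1) N).eRank ∧
  (subHankel Φ f₀ (N + 1) N).eRank = (subHankel Φ f₀ N (N + 1)).eRank

/-- The column space of `H_{Φ,N,N+1}`. -/
abbrev colSpace (Φ : Set (IOMap Q m p)) (f₀ : Φ) (N : ℕ) :
    Submodule ℝ (WordLE Q N × (Q × Fin p) → ℝ) :=
  Submodule.span ℝ (range (subHankel Φ f₀ N (N + 1)).col)

/-- The column of `H_{Φ,N,N+1}` indexed by `(w, j)`, as an element of the column space. -/
def column (Φ : Set (IOMap Q m p)) (f₀ : Φ) (N : ℕ) (w : WordLE Q (N + 1))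
    (j : Φ ⊕ (Q × Fin m)) : colSpace Φ f₀ N :=
  ⟨(subHankel Φ f₀ N (N + 1)).col (w, j), Submodule.subset_span (mem_range_self _)⟩

end Hankel

/-! ### Realizations, partial realizations and the algorithm -/

namespace Realization

variable {Q : Type*} {m p : ℕ} {Φ : Set (IOMap Q m p)} {n : ℕ}

/-- `(Σ, μ)` is a realization of `Φ`. -/
def Realizes (R : Realization Φ n) : Prop :=
  ∀ (f : Φ) (u : PC m) (w : SwitchSeq Q), R.sys.output (R.μ f) u w = f.1 u w

/-- `(Σ, μ)` is a minimal realization of `Φ`. -/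
def IsMinimal (R : Realization Φ n) : Prop :=
  R.Realizes ∧ ∀ (n' : ℕ) (R' : Realization Φ n'), R'.Realizes → n ≤ n'

/-- `(Σ, μ)` is semi-reachable. -/
def SemiReachable (R : Realization Φ n) : Prop :=
  R.sys.SemiReachableFrom (range R.μ)

/-- `(Σ, μ)` is observable. -/
def Observable (R : Realization Φ n) : Prop :=
  R.sys.Observable

/-- `(Σ, μ)` is an `N`-partial realization of `Φ`. -/
def IsPartial (R : Realization Φ n) (N : ℕ) : Prop :=
  ∀ (f : Φ) (q : Q) (w : List Q), w.length ≤ N →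
    (∀ (q₀ : Q) (j : Fin m),
      markovInput f.1 q q₀ j w = R.sys.C q *ᵥ R.sys.runWord w ((R.sys.B q₀).col j)) ∧
    markovState f.1 q w = R.sys.C q *ᵥ R.sys.runWord w (R.μ f)

/-- `(Σ, μ)` is returned by the column-shift algorithm applied to `H_{Φ,N,N+1}` with the
isomorphism `iso` from the column space to `ℝⁿ`. The algorithm aborts iff there is no such
`(Σ, μ)`. -/
structure IsAlgorithmOutput (f₀ : Φ) (N : ℕ) (iso : colSpace Φ f₀ N ≃ₗ[ℝ] (Fin n → ℝ))
    (R : Realization Φ n) : Prop where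
  B_eq : ∀ (q : Q) (z : Fin m),
    (R.sys.B q).col z = iso (column Φ f₀ N ⟨[], by simp⟩ (Sum.inr (q, z)))
  C_eq : ∀ (q : Q) (w : WordLE Q (N + 1)) (j : Φ ⊕ (Q × Fin m)) (r : Fin p),
    (R.sys.C q *ᵥ iso (column Φ f₀ N w j)) r =
      subHankel Φ f₀ N (N + 1) (⟨[], by simp⟩, (q, r)) (w, j)
  A_eq : ∀ (q : Q) (w : WordLE Q N) (j : Φ ⊕ (Q × Fin m)),
    iso.symm (R.sys.A q *ᵥ iso (column Φ f₀ N ⟨w.1, by have := w.2; omega⟩ j)) =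
      column Φ f₀ N ⟨w.1 ++ [q], by simpa using w.2⟩ j
  μ_eq : ∀ f : Φ, R.μ f = iso (column Φ f₀ N ⟨[], by simp⟩ (Sum.inl f))

end Realization

end SwitchedSystem

end

/-! Regard the columns of H_Φ as functions of all rows. Let `colSpan M` be the span of those with
|w| ≤ M, and let `restrictRows L` keep the rows with |v| ≤ L. The rank of H_{Φ,L,M} is then the
dimension of the image of `colSpan M` under `restrictRows L`. Since an entry depends only on the
word wv, shifting rows from qv to v sends the column (w,j) to the column (wq,j).

Under (*), columns with |w| = N+1 add nothing after truncation to |v| ≤ N (`RankCondition.map_eq`),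
and an element of `colSpan N` that vanishes in the rows |v| ≤ N also vanishes in the rows |v| = N+1
(`RankCondition.restrictRows_succ_eq_zero`). Hence the shift descends to the column space of
H_{Φ,N,N+1}, and this is A_q. Up to N+1 letters lead from an initial state to a column, and up to N
further letters read off an entry of it: this gives 2N+1, and observability as well. For
semi-reachability, a functional vanishing on the reachable set is used as the output map of a system
with the same dynamics. Its output is zero, so its Markov parameters vanish, and the functional
kills every column.

If H_{Φ,N,N} already has full rank, then `colSpan N` contains all columns, the shift can be iterated
along any word, and all Markov parameters agree with those of Φ. That this forces equality of
input-output maps is the analytic part. Markov parameters are mixed derivatives at 0 of K, and of G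
with first time 0. By the merging rule, the n-th derivative in one time is a mixed derivative along
n repetitions of its mode, so the one-variable identity theorem can be applied to one time after
another (`IsKernel.eq_of_mixedDeriv_eq`). Outputs of systems have such kernels by variation of
constants (`LSS.isRepresentedBy_output`).

A realization of dimension n factors H_Φ through ℝⁿ (`Realizes.col_eq`). Hence rank H_Φ ≤ n, which
yields minimality. The reachable spans and the unobservable subspaces along words of length < k are
stationary from k = n on, so for n ≤ N+1 words of length ≤ N suffice for rows and columns. -/

open scoped NNReal Matrix

noncomputable section

namespace SwitchedSystem

/-! ### Functions that are analytic in the dwell times -/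

section ConstTimes

variable {Q X : Type*}

/-- A switching sequence regarded as one whose times are constant functions. -/
def constTimes (X : Type*) (l : List (Q × ℝ≥0)) : List (Q × (X → ℝ)) :=
  l.map fun c => (c.1, fun _ => (c.2 : ℝ))

@[simp]
theorem map_constTimes (l : List (Q × ℝ≥0)) (x : X) :
    ((constTimes X l).map fun c => (c.1, (c.2 x).toNNReal)) = l := by
  simp [constTimes, Function.comp_def]

theorem nonneg_of_mem_constTimes {l : List (Q × ℝ≥0)} {s : Set X} :
    ∀ c ∈ constTimes X l, ∀ x ∈ s, 0 ≤ c.2 x := by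
  intro c hc x _
  obtain ⟨a, -, rfl⟩ := List.mem_map.1 hc
  exact a.2.2

end ConstTimes

section Analytic

variable {Q E X : Type*} [NormedAddCommGroup E] [NormedSpace ℝ E]
  [NormedAddCommGroup X] [NormedSpace ℝ X]

theorem uniqueDiffOn_orthant (k : ℕ) : UniqueDiffOn ℝ {t : Fin k → ℝ | ∀ i, 0 ≤ t i} := by
  have h : {t : Fin k → ℝ | ∀ i, 0 ≤ t i} = Set.univ.pi fun _ => Ici (0 : ℝ) := by
    ext t; simp only [mem_ofPred_eq, Set.mem_pi, mem_univ, mem_Ici, true_implies]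
  rw [h]
  exact UniqueDiffOn.univ_pi fun _ => uniqueDiffOn_Ici 0

/-- Analyticity in the times is preserved by substituting analytic non-negative functions. -/
theorem AnalyticInTimes.comp_map {F : List (Q × ℝ≥0) → E} (hF : AnalyticInTimes F) {s : Set X}
    (l : List (Q × (X → ℝ))) (hl : ∀ c ∈ l, AnalyticOn ℝ c.2 s)
    (hl0 : ∀ c ∈ l, ∀ x ∈ s, 0 ≤ c.2 x) :
    AnalyticOn ℝ (fun x => F (l.map fun c => (c.1, (c.2 x).toNNReal))) s := by
  have h := (hF l.length fun i => (l.get i).1).comp (s := {t | ∀ i, 0 ≤ t i}) (t := s)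
    (g := fun x i => (l.get i).2 x) (AnalyticOn.pi fun i => hl _ (List.get_mem _ _))
    (fun x hx i => hl0 _ (List.get_mem _ _) x hx)
  refine h.congr fun x _ => ?_
  have : (List.ofFn fun i => ((l.get i).1, ((l.get i).2 x).toNNReal)) =
      l.map fun c => (c.1, (c.2 x).toNNReal) := by
    conv_rhs => rw [← List.ofFn_get l, List.map_ofFn]
    rfl
  simp only [Function.comp_apply, this]

theorem analyticOn_of_mem_constTimes {l : List (Q × ℝ≥0)} {s : Set X} :
    ∀ c ∈ constTimes X l, AnalyticOn ℝ c.2 s := by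
  intro c hc
  obtain ⟨a, -, rfl⟩ := List.mem_map.1 hc
  exact analyticOn_const

theorem AnalyticInTimes.append {F : List (Q × ℝ≥0) → E} (hF : AnalyticInTimes F)
    (l₁ l₂ : List (Q × ℝ≥0)) : AnalyticInTimes fun l => F (l₁ ++ l ++ l₂) := by
  intro k q
  have h := hF.comp_map (X := Fin k → ℝ) (s := {t | ∀ i, 0 ≤ t i})
    (constTimes _ l₁ ++ (List.ofFn fun i => (q i, fun t : Fin k → ℝ => t i)) ++ constTimes _ l₂)
    ?_ ?_
  · simpa [List.map_ofFn, Function.comp_def] using h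
  · intro c hc
    simp only [List.mem_append, List.mem_ofFn] at hc
    rcases hc with (hc | ⟨i, rfl⟩) | hc
    · exact analyticOn_of_mem_constTimes c hc
    · exact ((ContinuousLinearMap.proj (R := ℝ) (φ := fun _ : Fin k => ℝ) i).analyticOnNhd
        _).analyticOn
    · exact analyticOn_of_mem_constTimes c hc
  · intro c hc x hx
    simp only [List.mem_append, List.mem_ofFn] at hc
    rcases hc with (hc | ⟨i, rfl⟩) | hc
    · exact nonneg_of_mem_constTimes (s := {t | ∀ i, 0 ≤ t i}) c hc x hx
    · exact hx i
    · exact nonneg_of_mem_constTimes (s := {t | ∀ i, 0 ≤ t i}) c hc x hx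

theorem AnalyticInTimes.cons {F : List (Q × ℝ≥0) → E} (hF : AnalyticInTimes F)
    (c : Q × ℝ≥0) : AnalyticInTimes fun l => F (c :: l) := by
  simpa using hF.append [c] []

theorem AnalyticInTimes.concat {F : List (Q × ℝ≥0) → E} (hF : AnalyticInTimes F)
    (c : Q × ℝ≥0) : AnalyticInTimes fun l => F (l ++ [c]) := by
  simpa using hF.append [] [c]

/-- Dependence on one of the times. -/
theorem AnalyticInTimes.analyticOn_single {F : List (Q × ℝ≥0) → E} (hF : AnalyticInTimes F)
    (l₁ l₂ : List (Q × ℝ≥0)) (q : Q) :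
    AnalyticOn ℝ (fun t : ℝ => F (l₁ ++ (q, t.toNNReal) :: l₂)) (Ici 0) := by
  have h := hF.comp_map (X := ℝ) (s := Ici 0)
    (constTimes _ l₁ ++ (q, fun t => t) :: constTimes _ l₂) ?_ ?_
  · simpa using h
  · intro c hc
    simp only [List.mem_append, List.mem_cons] at hc
    rcases hc with hc | rfl | hc
    · exact analyticOn_of_mem_constTimes c hc
    · exact analyticOn_id
    · exact analyticOn_of_mem_constTimes c hc
  · intro c hc x hx
    simp only [List.mem_append, List.mem_cons] at hc
    rcases hc with hc | rfl | hc
    · exact nonneg_of_mem_constTimes (s := Ici 0) c hc x hx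
    · exact hx
    · exact nonneg_of_mem_constTimes (s := Ici 0) c hc x hx

/-- Joint dependence on the first and the last time. -/
theorem AnalyticInTimes.analyticOn_first_last {F : List (Q × ℝ≥0) → E} (hF : AnalyticInTimes F)
    (l : List (Q × ℝ≥0)) (q q' : Q) :
    AnalyticOn ℝ (fun z : ℝ × ℝ => F ((q, z.1.toNNReal) :: (l ++ [(q', z.2.toNNReal)])))
      (Ici 0 ×ˢ Ici 0) := by
  have h := hF.comp_map (X := ℝ × ℝ) (s := Ici 0 ×ˢ Ici 0)
    ((q, fun z => z.1) :: (constTimes _ l ++ [(q', fun z => z.2)])) ?_ ?_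
  · simpa using h
  · intro c hc
    simp only [List.mem_append, List.mem_cons, List.not_mem_nil, or_false] at hc
    rcases hc with rfl | hc | rfl
    · exact analyticOn_fst
    · exact analyticOn_of_mem_constTimes c hc
    · exact analyticOn_snd
  · intro c hc x hx
    simp only [List.mem_append, List.mem_cons, List.not_mem_nil, or_false] at hc
    rcases hc with rfl | hc | rfl
    · exact hx.1
    · exact nonneg_of_mem_constTimes (s := Ici 0 ×ˢ Ici 0) c hc x hx
    · exact hx.2

theorem AnalyticInTimes.add_const {F : List (Q × ℝ≥0) → E} (hF : AnalyticInTimes F) (c : E) :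
    AnalyticInTimes fun l => F l + c :=
  fun k q => (hF k q).add analyticOn_const

/-- The derivative at `0` with respect to an additional last time. -/
def lastDeriv (F : List (Q × ℝ≥0) → E) (q : Q) (l : List (Q × ℝ≥0)) : E :=
  derivWithin (fun t : ℝ => F (l ++ [(q, t.toNNReal)])) (Ici 0) 0

/-- The derivative is the Fréchet derivative within the orthant, applied to the last unit vector and
evaluated on the face where the last time is 0. Each of these operations preserves analyticity. -/
theorem AnalyticInTimes.lastDeriv {F : List (Q × ℝ≥0) → E} (hF : AnalyticInTimes F) (q : Q) :
    AnalyticInTimes (lastDeriv F q) := by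
  intro k q'
  set O : Set (Fin (k + 1) → ℝ) := {t | ∀ i, 0 ≤ t i} with hO
  set q'' : Fin (k + 1) → Q := Fin.snoc q' q with hq''
  set H : (Fin (k + 1) → ℝ) → E := fun t => F (List.ofFn fun i => (q'' i, (t i).toNNReal)) with hH
  have hHan : AnalyticOn ℝ H O := hF (k + 1) q''
  have hsn : ∀ (t : Fin k → ℝ) (τ : ℝ), H (Fin.snoc t τ) =
      F ((List.ofFn fun i => (q' i, (t i).toNNReal)) ++ [(q, τ.toNNReal)]) := by
    intro t τ
    simp only [hH, hq'', List.ofFn_succ', Fin.snoc_castSucc, Fin.snoc_last,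
      List.concat_eq_append]
  have hmem : ∀ t : Fin k → ℝ, (∀ i, 0 ≤ t i) → ∀ τ : ℝ, 0 ≤ τ →
      (Fin.snoc t τ : Fin (k + 1) → ℝ) ∈ O := by
    intro t ht τ hτ i
    refine Fin.lastCases ?_ (fun i => ?_) i
    · simpa using hτ
    · simpa using ht i
  have hd := (hHan.fderivWithin (uniqueDiffOn_orthant _)).comp
    (g := fun t : Fin k → ℝ => (Fin.snoc t 0 : Fin (k + 1) → ℝ)) (t := {t | ∀ i, 0 ≤ t i}) ?_
    (fun t ht => hmem t ht 0 le_rfl)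
  · have hd' := ((ContinuousLinearMap.apply ℝ E
      (Pi.single (Fin.last k) 1 : Fin (k + 1) → ℝ)).analyticOnNhd univ).analyticOn.comp hd
      (mapsTo_univ _ _)
    refine hd'.congr fun t ht => ?_
    have h1 : HasDerivWithinAt (fun τ : ℝ => (Fin.snoc t τ : Fin (k + 1) → ℝ))
        (Pi.single (Fin.last k) 1) (Ici 0) 0 := by
      rw [hasDerivWithinAt_pi]
      intro i
      refine Fin.lastCases ?_ (fun i => ?_) i
      · simp only [Fin.snoc_last, Pi.single_eq_same]
        exact hasDerivWithinAt_id (0 : ℝ) (Ici 0)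
      · simpa [Pi.single_apply, (Fin.castSucc_lt_last i).ne] using
          hasDerivWithinAt_const (0 : ℝ) (Ici 0) (t i)
    have h2 := (hHan.differentiableOn _ (hmem t ht 0 le_rfl)).hasFDerivWithinAt
    have h3 := h2.comp_hasDerivWithinAt (0 : ℝ) h1 (fun τ hτ => hmem t ht τ hτ)
    have h4 := h3.derivWithin (uniqueDiffOn_Ici (0 : ℝ) 0 self_mem_Ici)
    simp only [SwitchedSystem.lastDeriv, ← hsn]
    exact h4
  · refine AnalyticOn.pi fun i => ?_
    refine Fin.lastCases ?_ (fun i => ?_) i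
    · simpa using analyticOn_const
    · simp only [Fin.snoc_castSucc]
      exact ((ContinuousLinearMap.proj (R := ℝ) (φ := fun _ : Fin k => ℝ) i).analyticOnNhd
        _).analyticOn

theorem AnalyticInTimes.hasDerivWithinAt_lastDeriv {F : List (Q × ℝ≥0) → E}
    (hF : AnalyticInTimes F) (q : Q) (l : List (Q × ℝ≥0)) :
    HasDerivWithinAt (fun t : ℝ => F (l ++ [(q, t.toNNReal)])) (SwitchedSystem.lastDeriv F q l)
      (Ici 0) 0 :=
  ((hF.analyticOn_single l [] q).differentiableOn 0 self_mem_Ici).hasDerivWithinAt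

/-- Differentiation under the integral sign at a boundary point. -/
theorem hasDerivWithinAt_integral_of_analyticOn [CompleteSpace E] {H : ℝ × ℝ → E}
    (hH : AnalyticOn ℝ H (Ici 0 ×ˢ Ici 0)) (t : ℝ) (ht : 0 ≤ t) :
    HasDerivWithinAt (fun τ => ∫ s in (0 : ℝ)..t, H (s, τ))
      (∫ s in (0 : ℝ)..t, derivWithin (fun τ => H (s, τ)) (Ici 0) 0) (Ici 0) 0 := by
  have hdiff : ∀ s, 0 ≤ s → DifferentiableWithinAt ℝ (fun τ => H (s, τ)) (Ici 0) 0 := by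
    intro s hs
    have h1 : DifferentiableWithinAt ℝ (fun τ : ℝ => (s, τ)) (Ici 0) 0 := by fun_prop
    exact (hH.differentiableOn (s, 0) ⟨hs, self_mem_Ici⟩).comp (0 : ℝ) h1 (fun τ hτ => ⟨hs, hτ⟩)
  have hcont : ∀ τ, 0 ≤ τ → ContinuousOn (fun s => H (s, τ)) (Ici 0) := fun τ hτ =>
    hH.continuousOn.comp (f := fun s : ℝ => (s, τ)) (by fun_prop) (fun s hs => ⟨hs, hτ⟩)
  have hint : ∀ τ, 0 ≤ τ → IntervalIntegrable (fun s => H (s, τ)) volume 0 t := fun τ hτ =>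
    ((hcont τ hτ).mono (by rw [uIcc_of_le ht]; exact fun x hx => hx.1)).intervalIntegrable
  have huniq : UniqueDiffOn ℝ (Ici (0 : ℝ) ×ˢ Ici (0 : ℝ)) :=
    (uniqueDiffOn_Ici 0).prod (uniqueDiffOn_Ici 0)
  -- The derivative is bounded on the compact set [0,t] × [0,1]. By the mean value inequality this
  -- bounds the difference quotients in τ uniformly in s, which is the domination needed below.
  obtain ⟨C, hC⟩ : ∃ C, ∀ z ∈ Icc (0 : ℝ) t ×ˢ Icc (0 : ℝ) 1,
      ‖fderivWithin ℝ H (Ici 0 ×ˢ Ici 0) z‖ ≤ C := by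
    refine (isCompact_Icc.prod isCompact_Icc).exists_bound_of_continuousOn ?_
    exact (hH.fderivWithin huniq).continuousOn.mono fun z hz => ⟨hz.1.1, hz.2.1⟩
  have hlip : ∀ s ∈ Icc (0 : ℝ) t, ∀ τ ∈ Icc (0 : ℝ) 1, ‖H (s, τ) - H (s, 0)‖ ≤ C * τ := by
    intro s hs τ hτ
    have h := Convex.norm_image_sub_le_of_norm_hasFDerivWithin_le (𝕜 := ℝ) (f := H)
      (f' := fderivWithin ℝ H (Ici 0 ×ˢ Ici 0)) (C := C) (s := Icc (0 : ℝ) t ×ˢ Icc (0 : ℝ) 1)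
      (x := (s, 0)) (y := (s, τ))
      (fun z hz => (hH.differentiableOn z ⟨hz.1.1, hz.2.1⟩).hasFDerivWithinAt.mono
        fun z hz => ⟨hz.1.1, hz.2.1⟩) hC ((convex_Icc _ _).prod (convex_Icc _ _))
      ⟨hs, by simp⟩ ⟨hs, hτ⟩
    simpa [abs_of_nonneg hτ.1, Prod.norm_def, max_eq_right hτ.1] using h
  rw [← hasDerivWithinAt_Ioi_iff_Ici, hasDerivWithinAt_iff_tendsto_slope' (by simp)]
  have key := intervalIntegral.tendsto_integral_filter_of_dominated_convergence (μ := volume)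
    (a := 0) (b := t) (l := 𝓝[>] (0 : ℝ)) (F := fun τ s => slope (fun τ => H (s, τ)) 0 τ)
    (f := fun s => derivWithin (fun τ => H (s, τ)) (Ici 0) 0) (fun _ => C) ?_ ?_ ?_ ?_
  · refine key.congr' ?_
    filter_upwards [self_mem_nhdsWithin] with τ hτ
    have hτ0 : (0 : ℝ) ≤ τ := le_of_lt hτ
    simp only [slope_def_module, sub_zero]
    rw [intervalIntegral.integral_smul, intervalIntegral.integral_sub (hint τ hτ0) (hint 0 le_rfl)]
  · filter_upwards [self_mem_nhdsWithin] with τ hτ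
    have hτ0 : (0 : ℝ) ≤ τ := le_of_lt hτ
    simp only [slope_def_module, sub_zero]
    exact (((hint τ hτ0).sub (hint 0 le_rfl)).smul τ⁻¹).def'.aestronglyMeasurable
  · filter_upwards [Ioo_mem_nhdsGT (zero_lt_one' ℝ)] with τ hτ
    refine Eventually.of_forall fun s hs => ?_
    rw [uIoc_of_le ht] at hs
    rw [slope_def_module, sub_zero, norm_smul, norm_inv, Real.norm_of_nonneg hτ.1.le,
      inv_mul_le_iff₀ hτ.1, mul_comm]
    exact hlip s ⟨hs.1.le, hs.2⟩ τ ⟨hτ.1.le, hτ.2.le⟩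
  · exact intervalIntegrable_const
  · refine Eventually.of_forall fun s hs => ?_
    rw [uIoc_of_le ht] at hs
    have h := (hdiff s hs.1.le).hasDerivWithinAt
    rwa [← hasDerivWithinAt_Ioi_iff_Ici, hasDerivWithinAt_iff_tendsto_slope' (by simp)] at h

/-- The response to a constant input whose kernel, multiplied by the input value, is `G`. -/
def constInput (G : List (Q × ℝ≥0) → E) : List (Q × ℝ≥0) → E
  | [] => 0
  | (q, t) :: l => (∫ s in (0 : ℝ)..t, G ((q, s.toNNReal) :: l)) + constInput G l

/-- The integrals over earlier segments are differentiated under the integral sign; the new last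
segment contributes the primitive of s ↦ G [(q, s)], with derivative G [(q, 0)] at 0. -/
theorem hasDerivWithinAt_constInput [CompleteSpace E] {G : List (Q × ℝ≥0) → E}
    (hG : AnalyticInTimes G) (q : Q) (l : List (Q × ℝ≥0)) :
    HasDerivWithinAt (fun t : ℝ => constInput G (l ++ [(q, t.toNNReal)]))
      (constInput (lastDeriv G q) l + G [(q, 0)]) (Ici 0) 0 := by
  induction l with
  | nil =>
    have hc : Continuous fun s : ℝ => G [(q, s.toNNReal)] := by
      -- `Real.toNNReal` clamps at 0, so the integrand is continuous on all of ℝ and the two-sided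
      -- fundamental theorem applies at 0.
      have h := (hG.analyticOn_single [] [] q).continuousOn.comp_continuous
        (f := fun s : ℝ => max s 0) (by fun_prop) (fun s => mem_Ici.2 (le_max_right _ _))
      refine h.congr fun s => ?_
      rcases le_total s 0 with hs | hs
      · simp [hs, Real.toNNReal_of_nonpos hs]
      · simp [hs]
    have h := (intervalIntegral.integral_hasDerivAt_right (a := 0) (b := 0)
      (hc.intervalIntegrable _ _) hc.stronglyMeasurable.stronglyMeasurableAtFilter
      hc.continuousAt).hasDerivWithinAt (s := Ici 0)
    simp only [constInput, List.nil_append, add_zero, zero_add]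
    simp only [Real.toNNReal_zero] at h
    refine h.congr (fun t ht => ?_) (by simp)
    rw [Real.coe_toNNReal _ ht]
  | cons c l ih =>
    obtain ⟨q₁, t₁⟩ := c
    have h := hasDerivWithinAt_integral_of_analyticOn (hG.analyticOn_first_last l q₁ q) t₁ t₁.2
    have := h.add ih
    simp only [constInput, List.cons_append]
    rw [add_assoc]
    exact this

/-- The form "K plus constant-input response of G" is stable under `lastDeriv`, up to a constant
added to K. This is what drives the induction over words. -/
theorem lastDeriv_add_constInput [CompleteSpace E] {K G : List (Q × ℝ≥0) → E}
    (hK : AnalyticInTimes K) (hG : AnalyticInTimes G) (q : Q) :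
    lastDeriv (fun l => K l + constInput G l) q =
      fun l => lastDeriv K q l + G [(q, 0)] + constInput (lastDeriv G q) l := by
  funext l
  have h := ((hK.hasDerivWithinAt_lastDeriv q l).add
    (hasDerivWithinAt_constInput hG q l)).derivWithin (uniqueDiffOn_Ici (0 : ℝ) 0 self_mem_Ici)
  rw [add_assoc, add_comm (G _)]
  exact h

end Analytic

/-! ### Mixed derivatives -/

section Mixed

variable {Q : Type*} {p : ℕ}

/-- The innermost derivative is the one in the last time, so words are peeled off from the end. -/
theorem mixedDeriv_concat (g : List (Q × ℝ≥0) → Fin p → ℝ) (w : List Q) (q : Q) :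
    mixedDeriv g (w ++ [q]) = mixedDeriv (lastDeriv g q) w := by
  induction w generalizing g with
  | nil => rfl
  | cons a w ih =>
    simp only [List.cons_append, mixedDeriv, ih]
    rfl

theorem mixedDeriv_add_const (g : List (Q × ℝ≥0) → Fin p → ℝ) (c : Fin p → ℝ) {w : List Q}
    (hw : w ≠ []) : mixedDeriv (fun l => g l + c) w = mixedDeriv g w := by
  rw [← List.dropLast_append_getLast hw, mixedDeriv_concat, mixedDeriv_concat]
  congr 1
  funext l
  exact derivWithin_add_const c

/-- Each later derivative adds a constant to K, and the remaining derivative in the first time kills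
it. That first derivative finally turns the integral over the first segment into its integrand at 0.
-/
theorem mixedDeriv_add_constInput {K G : List (Q × ℝ≥0) → Fin p → ℝ}
    (hK : AnalyticInTimes K) (hG : AnalyticInTimes G) (q₀ : Q) (w : List Q) :
    mixedDeriv (fun l => K l + constInput G l) (q₀ :: w) =
      mixedDeriv K (q₀ :: w) + mixedDeriv (fun l => G ((q₀, 0) :: l)) w := by
  induction w using List.reverseRecOn generalizing K G with
  | nil =>
    have h := mixedDeriv_concat (fun l => K l + constInput G l) [] q₀
    rw [lastDeriv_add_constInput hK hG, List.nil_append] at h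
    rw [h]
    simp only [mixedDeriv, constInput, add_zero]
    rfl
  | append_singleton w q ih =>
    rw [← List.cons_append, mixedDeriv_concat, mixedDeriv_concat, mixedDeriv_concat,
      lastDeriv_add_constInput hK hG, ih ((hK.lastDeriv q).add_const _) (hG.lastDeriv q),
      mixedDeriv_add_const _ _ (List.cons_ne_nil _ _)]
    rfl

/-- Mixed derivatives with respect to the later times are analytic in the earlier ones. -/
theorem AnalyticInTimes.mixedDeriv {F : List (Q × ℝ≥0) → Fin p → ℝ} (hF : AnalyticInTimes F)
    (w : List Q) : AnalyticInTimes fun l => mixedDeriv (fun l' => F (l ++ l')) w := by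
  induction w using List.reverseRecOn generalizing F with
  | nil => simpa [SwitchedSystem.mixedDeriv] using hF
  | append_singleton w q ih =>
    have h := ih (hF.lastDeriv q)
    simp only [mixedDeriv_concat]
    convert h using 4
    unfold SwitchedSystem.lastDeriv
    simp

/-! ### The identity theorem for kernels -/

theorem eventuallyEq_zero_of_iteratedDeriv_eq_zero {E : Type*} [NormedAddCommGroup E]
    [NormedSpace ℝ E] [CompleteSpace E] {f : ℝ → E} {x : ℝ} (hf : AnalyticAt ℝ f x)
    (h : ∀ n, iteratedDeriv n f x = 0) : f =ᶠ[𝓝 x] 0 := by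
  obtain ⟨P, r, hP⟩ := hf
  have hz : ∀ n y, P n (fun _ => y) = 0 := by
    intro n y
    have h1 := hP.factorial_smul y n
    have h2 : iteratedFDeriv ℝ n f x (fun _ => y) = 0 := by
      rw [iteratedFDeriv_apply_eq_iteratedDeriv_mul_prod, h n, smul_zero]
    rw [h2] at h1
    rw [← Nat.cast_smul_eq_nsmul ℝ] at h1
    exact (smul_eq_zero.1 h1).resolve_left (Nat.cast_ne_zero.2 (Nat.factorial_ne_zero n))
  filter_upwards [Metric.eball_mem_nhds x hP.r_pos] with y hy
  have hs := hP.hasSum_sub hy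
  simp only [hz] at hs
  exact hs.unique hasSum_zero

/-- Functions that are analytic on `[0, ∞)` and have the same derivatives at `0` agree. -/
theorem eqOn_Ici_of_iteratedDerivWithin_eq {E : Type*} [NormedAddCommGroup E]
    [NormedSpace ℝ E] [CompleteSpace E] {f g : ℝ → E} (hf : AnalyticOn ℝ f (Ici 0))
    (hg : AnalyticOn ℝ g (Ici 0))
    (h : ∀ n, iteratedDerivWithin n f (Ici 0) 0 = iteratedDerivWithin n g (Ici 0) 0) :
    EqOn f g (Ici 0) := by
  -- One-sided germs at 0 are replaced by functions analytic in a full neighbourhood of 0 with the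
  -- same derivatives.
  obtain ⟨f', hff', hf'⟩ := analyticWithinAt_iff_exists_analyticAt.1 (hf 0 self_mem_Ici)
  obtain ⟨g', hgg', hg'⟩ := analyticWithinAt_iff_exists_analyticAt.1 (hg 0 self_mem_Ici)
  rw [insert_eq_of_mem self_mem_Ici] at hff' hgg'
  have hd : ∀ {a b : ℝ → E}, a =ᶠ[𝓝[Ici 0] 0] b → AnalyticAt ℝ b 0 → ∀ n,
      iteratedDerivWithin n a (Ici 0) 0 = iteratedDeriv n b 0 := by
    intro a b hab hb n
    have h1 : iteratedDerivWithin n a (Ici 0) 0 = iteratedDerivWithin n b (Ici 0) 0 := by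
      simp only [iteratedDerivWithin]
      rw [hab.iteratedFDerivWithin_eq (hab.self_of_nhdsWithin self_mem_Ici)]
    rw [h1, iteratedDerivWithin_eq_iteratedDeriv (uniqueDiffOn_Ici 0) hb.contDiffAt self_mem_Ici]
  have h0 : (f' - g') =ᶠ[𝓝 0] 0 := by
    refine eventuallyEq_zero_of_iteratedDeriv_eq_zero (hf'.sub hg') fun n => ?_
    rw [iteratedDeriv_sub hf'.contDiffAt hg'.contDiffAt, ← hd hff' hf' n, ← hd hgg' hg' n, h n,
      sub_self]
  have hev : ∀ᶠ t in 𝓝[Ici 0] (0 : ℝ), f t = g t := by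
    filter_upwards [hff', hgg', h0.filter_mono nhdsWithin_le_nhds] with t h1 h2 h3
    rw [h1, h2]
    exact sub_eq_zero.1 h3
  have hana : ∀ {a : ℝ → E}, AnalyticOn ℝ a (Ici 0) → AnalyticOnNhd ℝ a (Ioi 0) := fun ha =>
    (isOpen_Ioi.analyticOn_iff_analyticOnNhd).1 (ha.mono Ioi_subset_Ici_self)
  obtain ⟨ε, hε, hsub⟩ := mem_nhdsGE_iff_exists_Ico_subset.1 hev
  have hε : (0 : ℝ) < ε := hε
  have hIoi : EqOn f g (Ioi 0) := by
    -- The functions agree on [0, ε); its interior point ε/2 starts the identity theorem on the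
    -- connected set (0, ∞).
    refine (hana hf).eqOn_of_preconnected_of_eventuallyEq (hana hg) isPreconnected_Ioi
      (z₀ := ε / 2) (by simpa using hε) ?_
    filter_upwards [Ioo_mem_nhds (half_pos hε) (half_lt_self hε)] with t ht
    exact hsub ⟨ht.1.le, ht.2⟩
  intro t ht
  rcases eq_or_lt_of_le (show (0 : ℝ) ≤ t from ht) with rfl | ht
  · exact hev.self_of_nhdsWithin self_mem_Ici
  · exact hIoi ht

/-- The conditions on a family of kernels `K_w`, `w` a word. -/
structure IsKernel (K : List (Q × ℝ≥0) → Fin p → ℝ) : Prop where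
  analytic : AnalyticInTimes K
  merge : ∀ (w v : List (Q × ℝ≥0)) (q : Q) (t t' : ℝ≥0),
    K (w ++ (q, t) :: (q, t') :: v) = K (w ++ (q, t + t') :: v)
  drop_zero : ∀ (v w : List (Q × ℝ≥0)) (q : Q), w ≠ [] → K (v ++ (q, 0) :: w) = K (v ++ w)

/-- Dwelling t + s in q₁ is the same as dwelling t and then s. A derivative at t is therefore a
derivative at s = 0 of an inserted segment, and n derivatives insert n letters q₁. -/
theorem IsKernel.iteratedDerivWithin_mixedDeriv {K : List (Q × ℝ≥0) → Fin p → ℝ}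
    (hK : IsKernel K) (l : List (Q × ℝ≥0)) (q₁ q : Q) (w : List Q) (n : ℕ) {t : ℝ} (ht : 0 ≤ t) :
    iteratedDerivWithin n (fun t : ℝ =>
        mixedDeriv (fun l' => K (l ++ (q₁, t.toNNReal) :: (l' ++ [(q, 0)]))) w) (Ici 0) t =
      mixedDeriv (fun l' => K (l ++ (q₁, t.toNNReal) :: (l' ++ [(q, 0)])))
        (List.replicate n q₁ ++ w) := by
  induction n generalizing t with
  | zero => simp
  | succ n ih =>
    have hA : ∀ w', AnalyticOn ℝ (fun t : ℝ =>
        mixedDeriv (fun l' => K (l ++ (q₁, t.toNNReal) :: (l' ++ [(q, 0)]))) w') (Ici 0) := by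
      intro w'
      simpa using ((hK.analytic.concat (q, 0)).mixedDeriv w').analyticOn_single l [] q₁
    rw [iteratedDerivWithin_succ,
      derivWithin_congr (s := Ici (0 : ℝ)) (x := t) (fun s hs => ih (t := s) hs) (ih ht),
      List.replicate_succ, List.cons_append, mixedDeriv]
    set D : ℝ → Fin p → ℝ := fun t =>
      mixedDeriv (fun l' => K (l ++ (q₁, t.toNNReal) :: (l' ++ [(q, 0)])))
        (List.replicate n q₁ ++ w) with hD
    have h1 : HasDerivWithinAt D (derivWithin D (Ici 0) t) (Ici 0) (t + 0) := by
      rw [add_zero]; exact ((hA _).differentiableOn t ht).hasDerivWithinAt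
    have h2 := h1.scomp (0 : ℝ) (h := fun s => t + s) (h' := 1) (s := Ici 0)
      ((hasDerivWithinAt_id (0 : ℝ) _).const_add t) (fun s hs => add_nonneg ht hs)
    rw [one_smul] at h2
    rw [← h2.derivWithin (uniqueDiffOn_Ici (0 : ℝ) 0 self_mem_Ici)]
    have hst : ∀ s ∈ Ici (0 : ℝ), (D ∘ fun s => t + s) s =
        mixedDeriv (fun l' => K (l ++ (q₁, t.toNNReal) :: ((q₁, s.toNNReal) :: l' ++ [(q, 0)])))
          (List.replicate n q₁ ++ w) := by
      intro s hs
      simp only [hD, Function.comp_apply, List.cons_append, hK.merge,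
        Real.toNNReal_add ht (show (0 : ℝ) ≤ s from hs)]
    exact derivWithin_congr hst (hst 0 self_mem_Ici)

/-- Kernels are determined by their mixed derivatives at `0`. -/
theorem IsKernel.eq_of_mixedDeriv_eq {K K' : List (Q × ℝ≥0) → Fin p → ℝ} (hK : IsKernel K)
    (hK' : IsKernel K')
    (h : ∀ (w : List Q) (q : Q), mixedDeriv (fun l => K (l ++ [(q, 0)])) w =
      mixedDeriv (fun l => K' (l ++ [(q, 0)])) w)
    {l : List (Q × ℝ≥0)} (hl : l ≠ []) : K l = K' l := by
  -- A prefix with arbitrary times is allowed in front of the differentiated segments; the induction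
  -- frees these times one by one.
  have key : ∀ (l : List (Q × ℝ≥0)) (w : List Q) (q : Q),
      mixedDeriv (fun l' => K (l ++ (l' ++ [(q, 0)]))) w =
        mixedDeriv (fun l' => K' (l ++ (l' ++ [(q, 0)]))) w := by
    intro l
    induction l using List.reverseRecOn with
    | nil => simpa using h
    | append_singleton l c ih =>
      intro w q
      obtain ⟨q₁, t⟩ := c
      have hA : ∀ {K : List (Q × ℝ≥0) → Fin p → ℝ}, IsKernel K → AnalyticOn ℝ (fun t : ℝ =>
          mixedDeriv (fun l' => K (l ++ (q₁, t.toNNReal) :: (l' ++ [(q, 0)]))) w) (Ici 0) := by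
        intro K hK
        simpa using ((hK.analytic.concat (q, 0)).mixedDeriv w).analyticOn_single l [] q₁
      have heq := eqOn_Ici_of_iteratedDerivWithin_eq (hA hK) (hA hK') ?_
      · simpa using heq (show (t : ℝ) ∈ Ici 0 from t.2)
      · intro n
        rw [hK.iteratedDerivWithin_mixedDeriv l q₁ q w n le_rfl,
          hK'.iteratedDerivWithin_mixedDeriv l q₁ q w n le_rfl]
        -- At time 0 the segment of q₁ drops out, leaving the shorter prefix and a longer word.
        simpa [hK.drop_zero, hK'.drop_zero] using ih (List.replicate n q₁ ++ w) q
  rw [← List.dropLast_append_getLast hl]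
  generalize l.dropLast = l, l.getLast hl = c
  obtain ⟨q, t⟩ := c
  -- With the empty word, the trailing segment of length 0 merges into the last segment, which has
  -- the same mode.
  have h1 := key (l ++ [(q, t)]) [] q
  simpa [mixedDeriv, hK.merge, hK'.merge] using h1

end Mixed

/-! ### Piecewise-continuous inputs -/

section Inputs

variable {m : ℕ}

/-- The input `u`, started at time `τ`, as a function on the real line. -/
def PC.shift (u : PC m) (τ : ℝ≥0) (s : ℝ) : Fin m → ℝ := u.1 (s.toNNReal + τ)

theorem PC.countable_not_continuousAt (u : PC m) : {s | ¬ ContinuousAt u.1 s}.Countable := by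
  have h : {s | ¬ ContinuousAt u.1 s} ⊆ ⋃ k : ℕ, {s | s ≤ (k : ℝ≥0) ∧ ¬ ContinuousAt u.1 s} := by
    intro s hs
    obtain ⟨k, hk⟩ := exists_nat_ge s
    exact mem_iUnion.2 ⟨k, hk, hs⟩
  exact (countable_iUnion fun k => (u.2.1 _).countable).mono h

theorem PC.countable_not_continuousAt_shift (u : PC m) (τ : ℝ≥0) :
    {s : ℝ | 0 < s ∧ ¬ ContinuousAt (u.shift τ) s}.Countable := by
  refine MapsTo.countable_of_injOn (f := fun s : ℝ => s.toNNReal + τ)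
    (t := {s | ¬ ContinuousAt u.1 s}) ?_ ?_ u.countable_not_continuousAt
  · rintro s ⟨-, hs⟩ hc
    exact hs (ContinuousAt.comp (f := fun s : ℝ => s.toNNReal + τ) hc (by fun_prop))
  · rintro s ⟨hs, -⟩ s' ⟨hs', -⟩ h
    exact (Real.toNNReal_eq_toNNReal_iff hs.le hs'.le).1 (add_right_cancel h)

/-- One-sided limits bound u near each point, and compactness of [0, t] makes the bound uniform. -/
theorem PC.exists_bound (u : PC m) (t : ℝ≥0) : ∃ C, ∀ s ≤ t, ‖u.1 s‖ ≤ C := by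
  have hloc : ∀ s, ∃ C, ∀ᶠ x in 𝓝 s, ‖u.1 x‖ ≤ C := by
    have htend : ∀ (l : Filter ℝ≥0) (a : Fin m → ℝ), Tendsto u.1 l (𝓝 a) →
        ∀ᶠ x in l, ‖u.1 x‖ ≤ ‖a‖ + 1 := fun l a h =>
      (h.norm.eventually (gt_mem_nhds (lt_add_one _))).mono fun x hx => le_of_lt hx
    intro s
    by_cases hs : ContinuousAt u.1 s
    · exact ⟨_, htend _ _ hs⟩
    · obtain ⟨⟨a, ha⟩, ⟨b, hb⟩⟩ := u.2.2 s hs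
      refine ⟨max (max (‖b‖ + 1) (‖a‖ + 1)) ‖u.1 s‖, ?_⟩
      rw [← nhdsNE_sup_pure, ← nhdsLT_sup_nhdsGT, eventually_sup, eventually_sup, eventually_pure]
      refine ⟨⟨(htend _ _ hb).mono fun x hx => ?_, (htend _ _ ha).mono fun x hx => ?_⟩,
        le_max_right _ _⟩
      · exact hx.trans ((le_max_left _ _).trans (le_max_left _ _))
      · exact hx.trans ((le_max_right _ _).trans (le_max_left _ _))
  have h := (isCompact_Icc (a := (0 : ℝ≥0)) (b := t)).induction_on
    (p := fun A => ∃ C, ∀ s ∈ A, ‖u.1 s‖ ≤ C) ⟨0, by simp⟩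
    (fun A B hAB ⟨C, hC⟩ => ⟨C, fun s hs => hC s (hAB hs)⟩)
    (fun A B ⟨C, hC⟩ ⟨D, hD⟩ => ⟨max C D, fun s hs => hs.elim
      (fun h => (hC s h).trans (le_max_left _ _)) (fun h => (hD s h).trans (le_max_right _ _))⟩)
    (fun s _ => by
      obtain ⟨C, hC⟩ := hloc s
      exact ⟨_, mem_nhdsWithin_of_mem_nhds hC, C, fun x hx => hx⟩)
  obtain ⟨C, hC⟩ := h
  exact ⟨C, fun s hs => hC s ⟨zero_le, hs⟩⟩

theorem PC.aestronglyMeasurable_shift (u : PC m) (τ : ℝ≥0) (t : ℝ) :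
    AEStronglyMeasurable (u.shift τ) (volume.restrict (Ioc 0 t)) := by
  set D := {s : ℝ | 0 < s ∧ ¬ ContinuousAt (u.shift τ) s} with hD
  have hDc : D.Countable := u.countable_not_continuousAt_shift τ
  have h1 : ContinuousOn (u.shift τ) (Ioc 0 t \ D) := by
    rintro s ⟨hs, hsD⟩
    have : ContinuousAt (u.shift τ) s := by
      by_contra h
      exact hsD ⟨hs.1, h⟩
    exact this.continuousWithinAt
  have h2 := h1.aestronglyMeasurable (μ := volume) (measurableSet_Ioc.diff hDc.measurableSet)
  rwa [Measure.restrict_congr_set (sdiff_null_ae_eq_self (hDc.measure_zero _))] at h2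

theorem PC.intervalIntegrable_shift (u : PC m) (τ : ℝ≥0) {t : ℝ} (ht : 0 ≤ t) :
    IntervalIntegrable (u.shift τ) volume 0 t := by
  obtain ⟨C, hC⟩ := u.exists_bound (t.toNNReal + τ)
  rw [intervalIntegrable_iff_integrableOn_Ioc_of_le ht]
  refine Integrable.of_bound (u.aestronglyMeasurable_shift τ t) C ?_
  rw [ae_restrict_iff' measurableSet_Ioc]
  refine Eventually.of_forall fun s hs => hC _ ?_
  gcongr
  exact hs.2

theorem intervalIntegrable_clm_apply {E F : Type*} [NormedAddCommGroup E] [NormedSpace ℝ E]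
    [NormedAddCommGroup F] [NormedSpace ℝ F] {L : ℝ → E →L[ℝ] F} {f : ℝ → E} {a b : ℝ}
    (hL : Continuous L) (hf : IntervalIntegrable f volume a b) :
    IntervalIntegrable (fun s => L s (f s)) volume a b := by
  obtain ⟨C, hC⟩ := isCompact_uIcc.exists_bound_of_continuousOn (s := uIcc a b) hL.continuousOn
  rw [intervalIntegrable_iff] at hf ⊢
  refine (hf.norm.const_mul C).mono' ?_ ?_
  · have h := (ContinuousLinearMap.id ℝ (E →L[ℝ] F)).aestronglyMeasurable_comp₂
      hL.aestronglyMeasurable.restrict hf.aestronglyMeasurable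
    exact h
  · rw [ae_restrict_iff' measurableSet_uIoc]
    refine Eventually.of_forall fun s hs => ((L s).le_opNorm _).trans ?_
    gcongr
    exact hC s (uIoc_subset_uIcc hs)

end Inputs

/-! ### Variation of constants -/

section Solution

variable {n m : ℕ}

/-- A matrix as a continuous linear map. -/
def mulVecCLM (A : Matrix (Fin n) (Fin m) ℝ) : (Fin m → ℝ) →L[ℝ] (Fin n → ℝ) :=
  LinearMap.toContinuousLinearMap A.mulVecLin

@[simp]
theorem mulVecCLM_apply (A : Matrix (Fin n) (Fin m) ℝ) (x : Fin m → ℝ) :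
    mulVecCLM A x = A *ᵥ x := rfl

/-- The flow `e^{tA}` of `ẋ = A x`. -/
def expFlow (A : Matrix (Fin n) (Fin n) ℝ) (t : ℝ) : (Fin n → ℝ) →L[ℝ] (Fin n → ℝ) :=
  NormedSpace.exp (t • mulVecCLM A)

theorem analyticAt_expFlow (A : Matrix (Fin n) (Fin n) ℝ) (t : ℝ) :
    AnalyticAt ℝ (expFlow A) t := by
  have h : AnalyticAt ℝ (fun t : ℝ => t • mulVecCLM A) t := analyticAt_id.smul analyticAt_const
  exact AnalyticAt.comp (f := fun t : ℝ => t • mulVecCLM A)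
    (NormedSpace.exp_analytic (𝕂 := ℝ) (t • mulVecCLM A)) h

theorem hasDerivAt_expFlow (A : Matrix (Fin n) (Fin n) ℝ) (t : ℝ) :
    HasDerivAt (expFlow A) (mulVecCLM A * expFlow A t) t :=
  hasDerivAt_exp_smul_const' (𝕂 := ℝ) (mulVecCLM A) t

theorem continuous_expFlow (A : Matrix (Fin n) (Fin n) ℝ) : Continuous (expFlow A) :=
  continuous_iff_continuousAt.2 fun t => (hasDerivAt_expFlow A t).continuousAt

@[simp]
theorem expFlow_zero (A : Matrix (Fin n) (Fin n) ℝ) : expFlow A 0 = 1 := by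
  simp [expFlow]

theorem expFlow_add (A : Matrix (Fin n) (Fin n) ℝ) (s t : ℝ) :
    expFlow A (s + t) = expFlow A s * expFlow A t := by
  let _ : NormedAlgebra ℚ ((Fin n → ℝ) →L[ℝ] (Fin n → ℝ)) := NormedAlgebra.restrictScalars ℚ ℝ _
  rw [expFlow, add_smul, NormedSpace.exp_add_of_commute]
  · rfl
  · exact ((Commute.refl _).smul_left _).smul_right _

theorem expFlow_apply_expFlow (A : Matrix (Fin n) (Fin n) ℝ) (s t : ℝ) (x : Fin n → ℝ) :
    expFlow A s (expFlow A t x) = expFlow A (s + t) x := by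
  rw [expFlow_add]; rfl

theorem expFlow_neg_mul (A : Matrix (Fin n) (Fin n) ℝ) (t : ℝ) :
    expFlow A (-t) * mulVecCLM A = mulVecCLM A * expFlow A (-t) := by
  have h1 := hasDerivAt_exp_smul_const (𝕂 := ℝ) (mulVecCLM A) (-t)
  have h2 := hasDerivAt_exp_smul_const' (𝕂 := ℝ) (mulVecCLM A) (-t)
  exact h1.unique h2

variable (A : Matrix (Fin n) (Fin n) ℝ) (B : Matrix (Fin n) (Fin m) ℝ) (u : PC m) (τ : ℝ≥0)
  (x₀ : Fin n → ℝ)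

theorem intervalIntegrable_expFlow {t : ℝ} (ht : 0 ≤ t) (r : ℝ) :
    IntervalIntegrable (fun s => expFlow A (r - s) (B *ᵥ u.shift τ s)) volume 0 t := by
  have hL : Continuous fun s => expFlow A (r - s) ∘L mulVecCLM B :=
    ((continuous_expFlow A).comp (by fun_prop)).clm_comp continuous_const
  exact intervalIntegrable_clm_apply (L := fun s => expFlow A (r - s) ∘L mulVecCLM B) hL
    (u.intervalIntegrable_shift τ ht)

/-- Integrating factor: off a countable set, the derivative of e^{-sA} x(s) is e^{-sA} B u(s), and
the fundamental theorem tolerates countably many exceptions. -/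
theorem IsSolution.eq {x : ℝ → Fin n → ℝ} (hx : IsSolution A B (u.shift τ) x₀ x) {t : ℝ}
    (ht : 0 ≤ t) :
    x t = expFlow A t (x₀ + ∫ s in (0 : ℝ)..t, expFlow A (0 - s) (B *ᵥ u.shift τ s)) := by
  obtain ⟨hc, h0, hd⟩ := hx
  have h := integral_eq_of_hasDerivAt_off_countable (fun s => expFlow A (0 - s) (x s))
    (fun s => expFlow A (0 - s) (B *ᵥ u.shift τ s)) (a := 0) (b := t)
    (u.countable_not_continuousAt_shift τ) ?_ ?_ (intervalIntegrable_expFlow A B u τ ht 0)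
  · rw [h, ← h0, map_add, map_sub, expFlow_apply_expFlow, expFlow_apply_expFlow]
    simp
  · refine ContinuousOn.clm_apply ?_ (hc.mono ?_)
    · exact ((continuous_expFlow A).comp (by fun_prop)).continuousOn
    · rw [uIcc_of_le ht]; exact fun s hs => hs.1
  · rintro s ⟨hs, hsD⟩
    rw [min_eq_left ht, max_eq_right ht] at hs
    have hcs : ContinuousAt (u.shift τ) s := by
      by_contra h
      exact hsD ⟨hs.1, h⟩
    have h1 : HasDerivAt (fun s => expFlow A (0 - s)) (-(mulVecCLM A * expFlow A (0 - s))) s := by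
      have := (hasDerivAt_expFlow A (0 - s)).scomp s ((hasDerivAt_id s).const_sub 0)
      simpa [Function.comp_def] using this
    have h2 := h1.clm_apply (hd s hs.1 hcs)
    refine h2.congr_deriv ?_
    have h3 := congrArg (fun L => L (x s)) (expFlow_neg_mul A s)
    simp only [mul_apply_eq_comp, mulVecCLM_apply] at h3
    simp [map_add, h3]

/-- Since `solution` is a choice, a formula for it needs both existence, proved here, and the
uniqueness in `IsSolution.eq`. -/
theorem isSolution_expFlow :
    IsSolution A B (u.shift τ) x₀ fun t =>
      expFlow A t (x₀ + ∫ s in (0 : ℝ)..t, expFlow A (0 - s) (B *ᵥ u.shift τ s)) := by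
  refine ⟨?_, by simp, fun t ht hct => ?_⟩
  · refine (continuous_expFlow A).continuousOn.clm_apply (continuousOn_const.add ?_)
    intro t ht
    have ht : (0 : ℝ) ≤ t := ht
    -- The upper end t + 1 makes [0, t + 1] a neighbourhood of t within [0, ∞).
    have h1 := intervalIntegral.continuousOn_primitive_interval' (a := 0)
      (intervalIntegrable_expFlow A B u τ (t := t + 1) (by linarith) 0) left_mem_uIcc
    rw [uIcc_of_le (by linarith)] at h1
    refine (h1 t ⟨ht, by linarith⟩).mono_of_mem_nhdsWithin ?_
    filter_upwards [self_mem_nhdsWithin, mem_nhdsWithin_of_mem_nhds (Iio_mem_nhds (lt_add_one t))]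
      with s hs hs'
    exact ⟨hs, le_of_lt hs'⟩
  · have hmeas : StronglyMeasurableAtFilter (fun s => expFlow A (0 - s) (B *ᵥ u.shift τ s))
        (𝓝 t) volume := by
      refine ⟨Ioc 0 (t + 1), Ioc_mem_nhds ht (lt_add_one t), ?_⟩
      have h := intervalIntegrable_expFlow A B u τ (t := t + 1) (by linarith) 0
      rw [intervalIntegrable_iff_integrableOn_Ioc_of_le (by linarith)] at h
      exact h.aestronglyMeasurable
    have hcont : ContinuousAt (fun s => expFlow A (0 - s) (B *ᵥ u.shift τ s)) t := by
      refine ContinuousAt.clm_apply ?_ ((mulVecCLM B).continuous.continuousAt.comp hct)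
      exact ((continuous_expFlow A).comp (by fun_prop)).continuousAt
    have h1 := intervalIntegral.integral_hasDerivAt_right
      (intervalIntegrable_expFlow A B u τ ht.le 0) hmeas hcont
    have h2 := (hasDerivAt_expFlow A t).clm_apply (h1.const_add x₀)
    refine h2.congr_deriv ?_
    rw [expFlow_apply_expFlow]
    simp

/-- The variation-of-constants formula. -/
theorem solution_eq {t : ℝ} (ht : 0 ≤ t) :
    solution A B (u.shift τ) x₀ t =
      expFlow A t x₀ + ∫ s in (0 : ℝ)..t, expFlow A (t - s) (B *ᵥ u.shift τ s) := by
  have h : IsSolution A B (u.shift τ) x₀ (solution A B (u.shift τ) x₀) :=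
    Classical.epsilon_spec (p := IsSolution A B (u.shift τ) x₀)
      ⟨_, isSolution_expFlow A B u τ x₀⟩
  rw [h.eq A B u τ x₀ ht, map_add,
    ← ContinuousLinearMap.intervalIntegral_comp_comm _ (intervalIntegrable_expFlow A B u τ ht 0)]
  simp only [expFlow_apply_expFlow, ← add_sub_assoc, add_zero]

end Solution

/-! ### Kernel representations of single input-output maps -/

section Representation

variable {Q : Type*} {m p : ℕ}

/-- The response to the input `u`, started at time `τ`, of the kernels `G`. -/
def inputTerm (G : List (Q × ℝ≥0) → (Fin m → ℝ) →ₗ[ℝ] (Fin p → ℝ)) (u : ℝ≥0 → Fin m → ℝ) :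
    ℝ≥0 → List (Q × ℝ≥0) → Fin p → ℝ
  | _, [] => 0
  | τ, (q, t) :: l =>
      (∫ s in (0 : ℝ)..t, G ((q, ((t : ℝ) - s).toNNReal) :: l) (u (s.toNNReal + τ))) +
        inputTerm G u (τ + t) l

theorem inputTerm_eq_sum (G : List (Q × ℝ≥0) → (Fin m → ℝ) →ₗ[ℝ] (Fin p → ℝ))
    (u : ℝ≥0 → Fin m → ℝ) (τ : ℝ≥0) (l : List (Q × ℝ≥0)) :
    inputTerm G u τ l = ∑ i : Fin l.length,
      ∫ s in (0 : ℝ)..((l.get i).2 : ℝ),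
        G (((l.get i).1, (((l.get i).2 : ℝ) - s).toNNReal) :: l.drop (i + 1))
          (u (s.toNNReal + (τ + ((l.take i).map Prod.snd).sum))) := by
  induction l generalizing τ with
  | nil => simp [inputTerm]
  | cons c l ih =>
    obtain ⟨q, t⟩ := c
    rw [inputTerm, ih]
    refine Eq.trans ?_ (Fin.sum_univ_succ (n := l.length) _).symm
    simp [add_assoc]

/-- For a constant input, the substitution s ↦ t - s removes the convolution. -/
theorem inputTerm_const (G : List (Q × ℝ≥0) → (Fin m → ℝ) →ₗ[ℝ] (Fin p → ℝ))
    (a : Fin m → ℝ) (τ : ℝ≥0) (l : List (Q × ℝ≥0)) :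
    inputTerm G (fun _ => a) τ l = constInput (fun l => G l a) l := by
  induction l generalizing τ with
  | nil => rfl
  | cons c l ih =>
    obtain ⟨q, t⟩ := c
    rw [inputTerm, constInput, ih,
      intervalIntegral.integral_comp_sub_left (fun s => G ((q, s.toNNReal) :: l) a)]
    simp

theorem inputTerm_congr {G G' : List (Q × ℝ≥0) → (Fin m → ℝ) →ₗ[ℝ] (Fin p → ℝ)}
    (h : ∀ l, l ≠ [] → G l = G' l) (u : ℝ≥0 → Fin m → ℝ) (τ : ℝ≥0) (l : List (Q × ℝ≥0)) :
    inputTerm G u τ l = inputTerm G' u τ l := by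
  induction l generalizing τ with
  | nil => rfl
  | cons c l ih =>
    obtain ⟨q, t⟩ := c
    simp only [inputTerm, ih, h _ (List.cons_ne_nil _ _)]

theorem constInput_zero (l : List (Q × ℝ≥0)) : constInput (fun _ => (0 : Fin p → ℝ)) l = 0 := by
  induction l with
  | nil => rfl
  | cons c l ih => simp [constInput, ih]

theorem constInput_concat_zero (G : List (Q × ℝ≥0) → Fin p → ℝ) (q : Q) (l : List (Q × ℝ≥0)) :
    constInput G (l ++ [(q, 0)]) = constInput (fun l => G (l ++ [(q, 0)])) l := by
  induction l with
  | nil => simp [constInput]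
  | cons c l ih =>
    obtain ⟨q₁, t⟩ := c
    simp [constInput, ih]

/-- `f` is represented by the state kernels `K` and the input kernels `G`. -/
structure IsRepresentedBy (f : IOMap Q m p) (K : List (Q × ℝ≥0) → Fin p → ℝ)
    (G : List (Q × ℝ≥0) → (Fin m → ℝ) →ₗ[ℝ] (Fin p → ℝ)) : Prop where
  isKernel : IsKernel K
  analytic : ∀ a, AnalyticInTimes fun l => G l a
  merge : ∀ (w v : List (Q × ℝ≥0)) (q : Q) (t t' : ℝ≥0),
    G (w ++ (q, t) :: (q, t') :: v) = G (w ++ (q, t + t') :: v)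
  drop_zero : ∀ (v w : List (Q × ℝ≥0)) (q : Q), w ≠ [] → v ≠ [] →
    G (v ++ (q, 0) :: w) = G (v ++ w)
  eq : ∀ (u : PC m) (w : SwitchSeq Q), f u w = K w.1 + inputTerm G u.1 0 w.1

namespace IsRepresentedBy

variable {f f' : IOMap Q m p} {K K' : List (Q × ℝ≥0) → Fin p → ℝ}
  {G G' : List (Q × ℝ≥0) → (Fin m → ℝ) →ₗ[ℝ] (Fin p → ℝ)}

theorem apply_const (h : IsRepresentedBy f K G) (a : Fin m → ℝ) (q : Q) (l : List (Q × ℝ≥0)) :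
    f (PC.const a) ⟨l ++ [(q, 0)], by simp⟩ =
      K (l ++ [(q, 0)]) + constInput (fun l => G (l ++ [(q, 0)]) a) l := by
  rw [h.eq, PC.const, inputTerm_const, constInput_concat_zero]

theorem markovState_eq (h : IsRepresentedBy f K G) (q : Q) (w : List Q) :
    markovState f q w = mixedDeriv (fun l => K (l ++ [(q, 0)])) w := by
  simp only [markovState, ioDeriv, h.apply_const, map_zero, constInput_zero, add_zero]

/-- The contribution of K cancels in the difference, and the derivative in the first time evaluates
G at first time 0. -/
theorem markovInput_eq (h : IsRepresentedBy f K G) (q q₀ : Q) (j : Fin m) (w : List Q) :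
    markovInput f q q₀ j w =
      mixedDeriv (fun l => G ((q₀, 0) :: (l ++ [(q, 0)])) (Pi.single j 1)) w := by
  have h0 := h.markovState_eq q (q₀ :: w)
  rw [markovState] at h0
  rw [markovInput, h0]
  simp only [ioDeriv, h.apply_const]
  rw [mixedDeriv_add_constInput (h.isKernel.analytic.concat _)
    ((h.analytic (Pi.single j 1)).concat _), add_sub_cancel_left]
  rfl

/-- Freezing a leading segment of length 0 supplies the non-empty prefix that G needs to drop zero
times, so the uniqueness theorem for K also serves G. -/
theorem isKernel_cons (h : IsRepresentedBy f K G) (q₀ : Q) (a : Fin m → ℝ) :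
    IsKernel fun l => G ((q₀, 0) :: l) a where
  analytic := (h.analytic a).cons _
  merge w v q t t' := by
    have := h.merge ((q₀, 0) :: w) v q t t'
    simp only [List.cons_append] at this
    rw [this]
  drop_zero v w q hw := by
    have := h.drop_zero ((q₀, 0) :: v) w q hw (List.cons_ne_nil _ _)
    simp only [List.cons_append] at this
    rw [this]

/-- An input-output map with a kernel representation is determined by its Markov parameters. -/
theorem eq_of_markov_eq (h : IsRepresentedBy f K G) (h' : IsRepresentedBy f' K' G')
    (hs : ∀ q w, markovState f q w = markovState f' q w)
    (hi : ∀ q q₀ j w, markovInput f q q₀ j w = markovInput f' q q₀ j w) : f = f' := by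
  have hK : ∀ l, l ≠ [] → K l = K' l := fun l hl =>
    h.isKernel.eq_of_mixedDeriv_eq h'.isKernel
      (fun w q => by rw [← h.markovState_eq, ← h'.markovState_eq, hs]) hl
  have hG : ∀ l, l ≠ [] → G l = G' l := by
    intro l hl
    obtain ⟨⟨q₀, t⟩, l, rfl⟩ := List.exists_cons_of_ne_nil hl
    refine LinearMap.pi_ext' fun j => LinearMap.ext_ring ?_
    have h1 := (h.isKernel_cons q₀ (Pi.single j 1)).eq_of_mixedDeriv_eq
      (h'.isKernel_cons q₀ (Pi.single j 1))
      (fun w q => by rw [← h.markovInput_eq, ← h'.markovInput_eq, hi]) hl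
    -- Merging the frozen segment of length 0 with the first segment recovers G on the original
    -- sequence.
    have h2 := h.merge [] l q₀ 0 t
    have h3 := h'.merge [] l q₀ 0 t
    simp only [List.nil_append, zero_add] at h2 h3
    rw [h2, h3] at h1
    exact h1
  funext u w
  rw [h.eq, h'.eq, hK _ w.2, inputTerm_congr hG]

end IsRepresentedBy

theorem AnalyticInTimes.mulVec {G : List (Q × ℝ≥0) → Matrix (Fin p) (Fin m) ℝ}
    (hG : ∀ i j, AnalyticInTimes fun l => G l i j) (a : Fin m → ℝ) :
    AnalyticInTimes fun l => G l *ᵥ a := by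
  intro k q
  refine AnalyticOn.pi fun i => ?_
  simp only [Matrix.mulVec, dotProduct]
  exact Finset.analyticOn_fun_sum _ fun j _ => (hG i j k q).mul analyticOn_const

theorem HasGeneralizedKernelRepresentation.exists_isRepresentedBy {Φ : Set (IOMap Q m p)}
    (h : HasGeneralizedKernelRepresentation Φ) :
    ∃ G, ∀ f : Φ, ∃ K, IsRepresentedBy f.1 K G := by
  obtain ⟨K, G, ⟨hK, hG⟩, hm, hz, heq⟩ := h
  refine ⟨fun l => (G l).mulVecLin, fun f => ⟨K f, ⟨⟨hK f, ?_, ?_⟩, ?_, ?_, ?_, ?_⟩⟩⟩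
  · exact fun w v q t t' => (hm w v q t t').1 f
  · exact fun v w q hw => (hz v w q hw).1 f
  · exact fun a => AnalyticInTimes.mulVec hG a
  · exact fun w v q t t' => by rw [(hm w v q t t').2]
  · exact fun v w q hw hv => by rw [(hz v w q hw).2 hv]
  · intro u w
    rw [heq, inputTerm_eq_sum]
    simp only [zero_add]
    rfl

/-- All members share the same G, and K does not enter. Hence the choice of f₀ is immaterial. -/
theorem HasGeneralizedKernelRepresentation.markovInput_eq {Φ : Set (IOMap Q m p)}
    (h : HasGeneralizedKernelRepresentation Φ) (f f' : Φ) (q q₀ : Q) (j : Fin m) (w : List Q) :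
    markovInput f.1 q q₀ j w = markovInput f'.1 q q₀ j w := by
  obtain ⟨G, hG⟩ := h.exists_isRepresentedBy
  obtain ⟨K, hK⟩ := hG f
  obtain ⟨K', hK'⟩ := hG f'
  rw [hK.markovInput_eq, hK'.markovInput_eq]

end Representation

/-! ### Kernels of linear switched systems -/

namespace LSS

variable {Q : Type*} {m p n : ℕ} (S : LSS Q m p n)

/-- The flow of the autonomous switched system along a switching sequence. -/
def flow : List (Q × ℝ≥0) → (Fin n → ℝ) →L[ℝ] (Fin n → ℝ)
  | [] => 1
  | (q, t) :: l => flow l * expFlow (S.A q) t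

/-- The output map of the last mode of a switching sequence. -/
def lastC (l : List (Q × ℝ≥0)) : (Fin n → ℝ) →L[ℝ] (Fin p → ℝ) :=
  match l.getLast? with
  | none => 0
  | some c => mulVecCLM (S.C c.1)

/-- The output at the end of a switching sequence as a linear function of the initial state. -/
def response (l : List (Q × ℝ≥0)) : (Fin n → ℝ) →L[ℝ] (Fin p → ℝ) := S.lastC l ∘L S.flow l

/-- The input kernels of the system. -/
def inputKernel : List (Q × ℝ≥0) → (Fin m → ℝ) →ₗ[ℝ] (Fin p → ℝ)
  | [] => 0
  | (q, t) :: l => (S.response ((q, t) :: l)).toLinearMap ∘ₗ (S.B q).mulVecLin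

theorem flow_append (l l' : List (Q × ℝ≥0)) : S.flow (l ++ l') = S.flow l' * S.flow l := by
  induction l with
  | nil => simp [flow]
  | cons c l ih =>
    obtain ⟨q, t⟩ := c
    simp only [List.cons_append, flow, ih, mul_assoc]

theorem lastC_append_cons (l l' : List (Q × ℝ≥0)) (c : Q × ℝ≥0) :
    S.lastC (l ++ c :: l') = S.lastC (c :: l') := by
  simp only [lastC, List.getLast?_append, List.getLast?_cons, Option.some_or]

theorem lastC_cons_of_ne_nil (c : Q × ℝ≥0) {l : List (Q × ℝ≥0)} (hl : l ≠ []) :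
    S.lastC (c :: l) = S.lastC l := by
  obtain ⟨d, l, rfl⟩ := List.exists_cons_of_ne_nil hl
  exact S.lastC_append_cons [c] l d

theorem lastC_concat (l : List (Q × ℝ≥0)) (c : Q × ℝ≥0) :
    S.lastC (l ++ [c]) = mulVecCLM (S.C c.1) := by
  simp [lastC]

theorem lastC_cons_time (q : Q) (t t' : ℝ≥0) (l : List (Q × ℝ≥0)) :
    S.lastC ((q, t) :: l) = S.lastC ((q, t') :: l) := by
  rcases eq_or_ne l [] with rfl | hl
  · rfl
  · rw [S.lastC_cons_of_ne_nil _ hl, S.lastC_cons_of_ne_nil _ hl]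

theorem response_concat_zero (l : List (Q × ℝ≥0)) (q : Q) (x : Fin n → ℝ) :
    S.response (l ++ [(q, 0)]) x = S.C q *ᵥ S.flow l x := by
  simp [response, lastC_concat, flow_append, flow]

theorem response_merge (w v : List (Q × ℝ≥0)) (q : Q) (t t' : ℝ≥0) :
    S.response (w ++ (q, t) :: (q, t') :: v) = S.response (w ++ (q, t + t') :: v) := by
  simp only [response, lastC_append_cons, flow_append, flow]
  rw [S.lastC_cons_of_ne_nil _ (List.cons_ne_nil _ _), S.lastC_cons_time q t' (t + t'), NNReal.coe_add,
    add_comm (t : ℝ), expFlow_add]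
  simp only [mul_assoc]

theorem response_drop_zero (v w : List (Q × ℝ≥0)) (q : Q) (hw : w ≠ []) :
    S.response (v ++ (q, 0) :: w) = S.response (v ++ w) := by
  obtain ⟨d, w, rfl⟩ := List.exists_cons_of_ne_nil hw
  simp only [response, lastC_append_cons, flow_append]
  rw [S.lastC_cons_of_ne_nil _ (List.cons_ne_nil _ _), flow]
  simp

theorem analyticOn_flow {k : ℕ} (q : Fin k → Q) :
    AnalyticOn ℝ (fun t : Fin k → ℝ => S.flow (List.ofFn fun i => (q i, (t i).toNNReal)))
      {t | ∀ i, 0 ≤ t i} := by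
  induction k with
  | zero =>
    simp only [List.ofFn_zero]
    exact analyticOn_const
  | succ k ih =>
    have h1 := (ih fun i => q i.succ).comp (g := fun (t : Fin (k + 1) → ℝ) i => t (Fin.succ i))
      (t := {t | ∀ i, 0 ≤ t i}) (AnalyticOn.pi fun i =>
        ((ContinuousLinearMap.proj (R := ℝ) (φ := fun _ : Fin (k + 1) => ℝ) i.succ).analyticOnNhd
          _).analyticOn) (fun t ht i => ht i.succ)
    have h2 : AnalyticOn ℝ (fun t : Fin (k + 1) → ℝ => expFlow (S.A (q 0)) (t 0))
        {t | ∀ i, 0 ≤ t i} := fun t _ => by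
      refine AnalyticAt.analyticWithinAt ?_
      exact AnalyticAt.comp (f := fun t : Fin (k + 1) → ℝ => t 0) (analyticAt_expFlow _ _)
        ((ContinuousLinearMap.proj (R := ℝ) (φ := fun _ : Fin (k + 1) => ℝ) 0).analyticAt t)
    refine (h1.mul h2).congr fun t ht => ?_
    simp only [List.ofFn_succ, flow, Real.coe_toNNReal _ (ht 0)]
    rfl

theorem analyticInTimes_response (x : Fin n → ℝ) : AnalyticInTimes fun l => S.response l x := by
  intro k q
  cases k with
  | zero =>
    simp only [List.ofFn_zero]
    exact analyticOn_const
  | succ k =>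
    have h := ((mulVecCLM (S.C (q (Fin.last k))) ∘L
      ContinuousLinearMap.apply ℝ (Fin n → ℝ) x).analyticOnNhd univ).analyticOn.comp
      (S.analyticOn_flow q) (mapsTo_univ _ _)
    refine h.congr fun t _ => ?_
    have hC : S.lastC (List.ofFn fun i => (q i, (t i).toNNReal)) =
        mulVecCLM (S.C (q (Fin.last k))) := by
      rw [List.ofFn_succ', List.concat_eq_append, lastC_concat]
    simp only [response, hC]
    rfl

theorem isKernel_response (x : Fin n → ℝ) : IsKernel fun l => S.response l x where
  analytic := S.analyticInTimes_response x
  merge w v q t t' := by rw [S.response_merge]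
  drop_zero v w q hw := by rw [S.response_drop_zero v w q hw]

theorem analyticInTimes_inputKernel (a : Fin m → ℝ) :
    AnalyticInTimes fun l => S.inputKernel l a := by
  intro k q
  cases k with
  | zero =>
    simp only [List.ofFn_zero]
    exact analyticOn_const
  | succ k =>
    refine (S.analyticInTimes_response (S.B (q 0) *ᵥ a) (k + 1) q).congr fun t _ => ?_
    simp only [List.ofFn_succ, inputKernel]
    rfl

/-- Variation of constants on the first segment; the later flow and the output map are linear and
move inside the integral, where they form the input kernel. -/
theorem lastC_stateFrom (u : PC m) (τ : ℝ≥0) (x : Fin n → ℝ) {l : List (Q × ℝ≥0)} (hl : l ≠ []) :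
    S.lastC l (S.stateFrom u τ x l) = S.response l x + inputTerm S.inputKernel u.1 τ l := by
  induction l generalizing τ x with
  | nil => exact absurd rfl hl
  | cons c l ih =>
    obtain ⟨q, t⟩ := c
    set y := solution (S.A q) (S.B q) (u.shift τ) x (t : ℝ) with hy
    have h1 : S.lastC ((q, t) :: l) (S.stateFrom u τ x ((q, t) :: l)) =
        S.lastC ((q, t) :: l) (S.flow l y) + inputTerm S.inputKernel u.1 (τ + t) l := by
      rcases eq_or_ne l [] with rfl | hl'
      · simp only [stateFrom, flow, inputTerm, add_zero, hy]
        rfl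
      · rw [S.lastC_cons_of_ne_nil _ hl']
        exact ih (τ + t) y hl'
    rw [h1, inputTerm, ← add_assoc]
    congr 1
    rw [hy, solution_eq _ _ _ _ _ t.coe_nonneg, map_add, map_add,
      ← ContinuousLinearMap.comp_apply (S.lastC _) (S.flow l) (intervalIntegral _ _ _ _),
      ← ContinuousLinearMap.intervalIntegral_comp_comm _
        (intervalIntegrable_expFlow (S.A q) (S.B q) u τ t.coe_nonneg t)]
    congr 1
    refine intervalIntegral.integral_congr fun s hs => ?_
    rw [uIcc_of_le t.coe_nonneg] at hs
    simp only [inputKernel, response, S.lastC_cons_time q ((t : ℝ) - s).toNNReal t, flow,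
      Real.coe_toNNReal _ (sub_nonneg.2 hs.2)]
    rfl

theorem lastC_eq {l : List (Q × ℝ≥0)} (hl : l ≠ []) :
    S.lastC l = mulVecCLM (S.C (l.getLast hl).1) := by
  rw [lastC, List.getLast?_eq_some_getLast hl]

theorem isRepresentedBy_output (x : Fin n → ℝ) :
    IsRepresentedBy (S.output x) (fun l => S.response l x) S.inputKernel where
  isKernel := S.isKernel_response x
  analytic := S.analyticInTimes_inputKernel
  merge w v q t t' := by
    have h := S.response_merge w v q t t'
    cases w with
    | nil => simp only [List.nil_append, inputKernel] at h ⊢; rw [h]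
    | cons c w => simp only [List.cons_append, inputKernel] at h ⊢; rw [h]
  drop_zero v w q hw hv := by
    have h := S.response_drop_zero v w q hw
    obtain ⟨c, v, rfl⟩ := List.exists_cons_of_ne_nil hv
    simp only [List.cons_append, inputKernel] at h ⊢
    rw [h]
  eq u w := by
    rw [← S.lastC_stateFrom u 0 x w.2, S.lastC_eq w.2]
    rfl

@[simp]
theorem runWord_cons (q : Q) (w : List Q) (x : Fin n → ℝ) :
    S.runWord (q :: w) x = S.runWord w (S.A q *ᵥ x) := rfl

theorem runWord_append (w v : List Q) (x : Fin n → ℝ) :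
    S.runWord (w ++ v) x = S.runWord v (S.runWord w x) := by
  simp [runWord, List.foldl_append]

/-- `runWord` as a linear map. -/
def runWordLin : List Q → (Fin n → ℝ) →ₗ[ℝ] (Fin n → ℝ)
  | [] => LinearMap.id
  | q :: w => runWordLin w ∘ₗ (S.A q).mulVecLin

@[simp]
theorem runWordLin_apply (w : List Q) (x : Fin n → ℝ) : S.runWordLin w x = S.runWord w x := by
  induction w generalizing x with
  | nil => rfl
  | cons q w ih => simp [runWordLin, ih]

/-- By induction the inner derivatives are a fixed linear map applied to e^{tA_q} x, whose
derivative at t = 0 is A_q x. -/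
theorem mixedDeriv_flow (c : (Fin n → ℝ) →L[ℝ] (Fin p → ℝ)) (w : List Q) (x : Fin n → ℝ) :
    mixedDeriv (fun l => c (S.flow l x)) w = c (S.runWord w x) := by
  induction w generalizing x with
  | nil => rfl
  | cons q w ih =>
    have h1 := ((hasDerivAt_expFlow (S.A q) 0).clm_apply (hasDerivAt_const (0 : ℝ) x))
    have h2 := (c ∘L LinearMap.toContinuousLinearMap (S.runWordLin w)).hasFDerivAt.comp_hasDerivAt
      (0 : ℝ) h1
    have h3 := (h2.hasDerivWithinAt (s := Ici 0)).derivWithin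
      (uniqueDiffOn_Ici (0 : ℝ) 0 self_mem_Ici)
    rw [mixedDeriv]
    have h4 : ∀ t ∈ Ici (0 : ℝ),
        mixedDeriv (fun l => c (S.flow ((q, t.toNNReal) :: l) x)) w =
          c (S.runWord w (expFlow (S.A q) t x)) := by
      intro t ht
      rw [← ih]
      simp only [flow, Real.coe_toNNReal _ (show (0 : ℝ) ≤ t from ht)]
      rfl
    rw [derivWithin_congr h4 (h4 0 self_mem_Ici)]
    refine Eq.trans ?_ (h3.trans ?_)
    · congr 1
      funext t
      simp
    · simp

theorem markovState_output (x : Fin n → ℝ) (q : Q) (w : List Q) :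
    markovState (S.output x) q w = S.C q *ᵥ S.runWord w x := by
  rw [(S.isRepresentedBy_output x).markovState_eq]
  simp only [response_concat_zero]
  exact S.mixedDeriv_flow (mulVecCLM (S.C q)) w x

theorem markovInput_output (x : Fin n → ℝ) (q q₀ : Q) (j : Fin m) (w : List Q) :
    markovInput (S.output x) q q₀ j w = S.C q *ᵥ S.runWord w ((S.B q₀).col j) := by
  rw [(S.isRepresentedBy_output x).markovInput_eq]
  have h : ∀ l : List (Q × ℝ≥0), S.inputKernel ((q₀, 0) :: (l ++ [(q, 0)])) (Pi.single j 1) =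
      mulVecCLM (S.C q) (S.flow l ((S.B q₀).col j)) := by
    intro l
    have := S.response_drop_zero [] (l ++ [(q, 0)]) q₀ (by simp)
    rw [List.nil_append, List.nil_append] at this
    rw [inputKernel, this, mulVecCLM_apply, ← S.response_concat_zero]
    simp
  simp only [h]
  exact S.mixedDeriv_flow (mulVecCLM (S.C q)) w _

end LSS

/-! ### Linear algebra of Hankel matrices -/

section LinearAlgebra

/-- A linear map that preserves the dimension of a subspace is injective on it. -/
theorem eq_zero_of_finrank_map_eq {E F : Type*} [AddCommGroup E] [Module ℝ E] [AddCommGroup F]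
    [Module ℝ F] (g : E →ₗ[ℝ] F) (Y : Submodule ℝ E) [FiniteDimensional ℝ Y]
    (h : Module.finrank ℝ (Y.map g) = Module.finrank ℝ Y) {y : E} (hy : y ∈ Y) (h0 : g y = 0) :
    y = 0 := by
  have h1 := (g.domRestrict Y).finrank_range_add_finrank_ker
  rw [LinearMap.range_domRestrict, h, Nat.add_eq_left, Submodule.finrank_eq_zero] at h1
  have h2 : (⟨y, hy⟩ : Y) ∈ (g.domRestrict Y).ker := h0
  rw [h1, Submodule.mem_bot] at h2
  exact congrArg Subtype.val h2

/-- A bounded monotone sequence that stays constant once two successive terms agree. -/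
theorem eq_of_le_of_stable {d : ℕ → ℕ} {n : ℕ} (hmono : Monotone d) (hn : ∀ k, d k ≤ n)
    (hst : ∀ k, d k = d (k + 1) → d (k + 1) = d (k + 2)) {k l : ℕ} (hk : n ≤ k) (hl : k ≤ l) :
    d k = d l := by
  have hconst : ∀ {k}, d k = d (k + 1) → ∀ i, d (k + i) = d (k + i + 1) := by
    intro k h i
    induction i with
    | zero => exact h
    | succ i ih => exact hst _ ih
  -- Before stabilizing, the sequence gains at least 1 per step, so the bound n leaves at most n
  -- such steps.
  have hgrow : ∀ k, d k = d (k + 1) ∨ k + 1 ≤ d (k + 1) := by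
    intro k
    induction k with
    | zero =>
      have := hmono (Nat.zero_le 1)
      simp only [zero_add]
      omega
    | succ k ih =>
      have := hmono (Nat.le_succ (k + 1))
      rcases ih with ih | ih
      · exact Or.inl (hst k ih)
      · simp only [Nat.succ_eq_add_one] at this
        omega
  have hk' : d k = d (k + 1) := by
    rcases hgrow k with h | h
    · exact h
    · have := hn (k + 1); omega
  obtain ⟨i, rfl⟩ := Nat.exists_eq_add_of_le hl
  clear hl
  induction i with
  | zero => rfl
  | succ i ih => exact ih.trans (hconst hk' i)

end LinearAlgebra

section Hankel

variable {Q : Type*} {m p : ℕ}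

instance [Finite Q] (L : ℕ) : Finite (WordLE Q L) := (List.finite_length_le Q L).to_subtype

/-- Restriction to the rows `(v, i)` with `|v| ≤ L`. -/
def restrictRows (Q : Type*) (p L : ℕ) :
    (List Q × (Q × Fin p) → ℝ) →ₗ[ℝ] (WordLE Q L × (Q × Fin p) → ℝ) :=
  LinearMap.funLeft ℝ ℝ (Prod.map Subtype.val id)

/-- The shift of a column that moves the row `(qv, i)` to `(v, i)`. -/
def shiftRows (p : ℕ) (q : Q) : (List Q × (Q × Fin p) → ℝ) →ₗ[ℝ] (List Q × (Q × Fin p) → ℝ) :=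
  LinearMap.funLeft ℝ ℝ fun vi => (q :: vi.1, vi.2)

variable (Φ : Set (IOMap Q m p)) (f₀ : Φ)

/-- The span of the columns `(w, j)` of the Hankel matrix with `|w| ≤ M`. -/
def colSpan (M : ℕ) : Submodule ℝ (List Q × (Q × Fin p) → ℝ) :=
  Submodule.span ℝ (range fun wj : WordLE Q M × (Φ ⊕ (Q × Fin m)) =>
    (hankel Φ f₀).col (wj.1.1, wj.2))

/-- The column space of the Hankel matrix. -/
def fullColSpan : Submodule ℝ (List Q × (Q × Fin p) → ℝ) :=
  Submodule.span ℝ (range (hankel Φ f₀).col)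

theorem col_mem_colSpan {M : ℕ} {w : List Q} (hw : w.length ≤ M) (j : Φ ⊕ (Q × Fin m)) :
    (hankel Φ f₀).col (w, j) ∈ colSpan Φ f₀ M :=
  Submodule.subset_span ⟨(⟨w, hw⟩, j), rfl⟩

theorem colSpan_mono : Monotone (colSpan Φ f₀) := by
  intro M M' h
  refine Submodule.span_le.2 ?_
  rintro _ ⟨⟨⟨w, hw⟩, j⟩, rfl⟩
  exact col_mem_colSpan Φ f₀ (hw.trans h) j

theorem colSpan_le_fullColSpan (M : ℕ) : colSpan Φ f₀ M ≤ fullColSpan Φ f₀ := by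
  refine Submodule.span_le.2 ?_
  rintro _ ⟨wj, rfl⟩
  exact Submodule.subset_span ⟨_, rfl⟩

/-- This is the Hankel structure: w(qv) = (wq)v. -/
theorem shiftRows_col (q : Q) (w : List Q) (j : Φ ⊕ (Q × Fin m)) :
    shiftRows p q ((hankel Φ f₀).col (w, j)) = (hankel Φ f₀).col (w ++ [q], j) := by
  funext vi
  rcases j with f | qz <;> simp [shiftRows, LinearMap.funLeft_apply, hankel, Matrix.col_apply]

theorem shiftRows_mem {M : ℕ} (q : Q) {x : List Q × (Q × Fin p) → ℝ} (hx : x ∈ colSpan Φ f₀ M) :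
    shiftRows p q x ∈ colSpan Φ f₀ (M + 1) := by
  suffices h : colSpan Φ f₀ M ≤ (colSpan Φ f₀ (M + 1)).comap (shiftRows p q) from h hx
  refine Submodule.span_le.2 ?_
  rintro _ ⟨⟨⟨w, hw⟩, j⟩, rfl⟩
  change shiftRows p q ((hankel Φ f₀).col (w, j)) ∈ colSpan Φ f₀ (M + 1)
  rw [shiftRows_col]
  exact col_mem_colSpan Φ f₀ (by simpa using hw) j

theorem span_subHankel (L M : ℕ) :
    Submodule.span ℝ (range (subHankel Φ f₀ L M).col) =
      (colSpan Φ f₀ M).map (restrictRows Q p L) := by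
  rw [colSpan, Submodule.map_span, ← range_comp]
  rfl

/-- Only finitely many words have bounded length, so there are finitely many rows and the rank is
finite even when Φ is infinite. -/
theorem eRank_subHankel [Finite Q] (L M : ℕ) :
    (subHankel Φ f₀ L M).eRank =
      (Module.finrank ℝ ((colSpan Φ f₀ M).map (restrictRows Q p L)) : ℕ∞) := by
  rw [Matrix.eRank, Matrix.cRank, span_subHankel, ← Module.finrank_eq_rank, Cardinal.toENat_nat]

theorem colSpace_eq (N : ℕ) :
    colSpace Φ f₀ N = (colSpan Φ f₀ (N + 1)).map (restrictRows Q p N) :=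
  span_subHankel Φ f₀ N (N + 1)

theorem restrictRows_mem_colSpace {N : ℕ} {x : List Q × (Q × Fin p) → ℝ}
    (hx : x ∈ colSpan Φ f₀ (N + 1)) : restrictRows Q p N x ∈ colSpace Φ f₀ N := by
  rw [colSpace_eq]
  exact Submodule.mem_map_of_mem hx

/-- Restriction of rows in two steps. -/
theorem exists_restrictRows_comp (p : ℕ) {L L' : ℕ} (h : L ≤ L') :
    ∃ g : (WordLE Q L' × (Q × Fin p) → ℝ) →ₗ[ℝ] (WordLE Q L × (Q × Fin p) → ℝ),
      g ∘ₗ restrictRows Q p L' = restrictRows Q p L :=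
  ⟨LinearMap.funLeft ℝ ℝ (Prod.map (fun w => ⟨w.1, w.2.trans h⟩) id), rfl⟩

variable {Φ f₀}

/-- An inclusion of spaces whose dimensions agree by rank H_{Φ,N,N} = rank H_{Φ,N,N+1}. -/
theorem RankCondition.map_eq [Finite Q] {N : ℕ} (h : RankCondition Φ f₀ N) :
    (colSpan Φ f₀ N).map (restrictRows Q p N) = colSpace Φ f₀ N := by
  rw [colSpace_eq]
  refine Submodule.eq_of_le_of_finrank_eq
    (Submodule.map_mono (colSpan_mono Φ f₀ (Nat.le_succ N))) ?_
  have := h.1.trans h.2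
  rw [eRank_subHankel, eRank_subHankel] at this
  exact_mod_cast this

/-- By rank H_{Φ,N,N} = rank H_{Φ,N+1,N}, forgetting the rows of length N+1 preserves dimension and
is therefore injective. -/
theorem RankCondition.restrictRows_succ_eq_zero [Finite Q] {N : ℕ} (h : RankCondition Φ f₀ N)
    {x : List Q × (Q × Fin p) → ℝ} (hx : x ∈ colSpan Φ f₀ N) (h0 : restrictRows Q p N x = 0) :
    restrictRows Q p (N + 1) x = 0 := by
  obtain ⟨g, hg⟩ := exists_restrictRows_comp (Q := Q) p (Nat.le_succ N)
  have h1 := h.1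
  rw [eRank_subHankel, eRank_subHankel, ← hg, Submodule.map_comp] at h1
  refine eq_zero_of_finrank_map_eq g _ (by exact_mod_cast h1) (Submodule.mem_map_of_mem hx) ?_
  rw [← LinearMap.comp_apply, hg, h0]

theorem RankCondition.exists_eq [Finite Q] {N : ℕ} (h : RankCondition Φ f₀ N)
    (y : colSpace Φ f₀ N) : ∃ x ∈ colSpan Φ f₀ N, y.1 = restrictRows Q p N x := by
  obtain ⟨x, hx, hxy⟩ := h.map_eq.ge y.2
  exact ⟨x, hx, hxy.symm⟩

theorem colSpace_hom_ext {E : Type*} [AddCommGroup E] [Module ℝ E] {N : ℕ}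
    {g g' : colSpace Φ f₀ N →ₗ[ℝ] E}
    (h : ∀ w j, g (column Φ f₀ N w j) = g' (column Φ f₀ N w j)) : g = g' := by
  ext ⟨y, hy⟩
  induction hy using Submodule.span_induction with
  | mem y hy =>
    obtain ⟨⟨w, j⟩, rfl⟩ := hy
    exact h w j
  | zero => exact (map_zero g).trans (map_zero g').symm
  | add y y' hy hy' ih ih' =>
    have := congrArg₂ (· + ·) ih ih'
    simp only [← map_add] at this
    exact this
  | smul a y hy ih =>
    have := congrArg (a • ·) ih
    simp only [← map_smul] at this
    exact this

/-- The shift of columns, defined on the column space under the rank condition. -/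
theorem RankCondition.exists_shift [Finite Q] {N : ℕ} (h : RankCondition Φ f₀ N) (q : Q) :
    ∃ T : colSpace Φ f₀ N →ₗ[ℝ] colSpace Φ f₀ N, ∀ (w : WordLE Q N) (j : Φ ⊕ (Q × Fin m)),
      T (column Φ f₀ N ⟨w.1, by have := w.2; omega⟩ j) =
        column Φ f₀ N ⟨w.1 ++ [q], by simpa using w.2⟩ j := by
  let g : colSpan Φ f₀ N →ₗ[ℝ] colSpace Φ f₀ N := (restrictRows Q p N).restrict fun x hx =>
    restrictRows_mem_colSpace Φ f₀ (colSpan_mono Φ f₀ (Nat.le_succ N) hx)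
  let g' : colSpan Φ f₀ N →ₗ[ℝ] colSpace Φ f₀ N :=
    (restrictRows Q p N ∘ₗ shiftRows p q).restrict fun x hx =>
      restrictRows_mem_colSpace Φ f₀ (shiftRows_mem Φ f₀ q hx)
  have hg : g.range = ⊤ := by
    refine LinearMap.range_eq_top.2 fun y => ?_
    obtain ⟨x, hx, hxy⟩ := h.exists_eq y
    exact ⟨⟨x, hx⟩, Subtype.ext hxy.symm⟩
  obtain ⟨s, hs⟩ := g.exists_rightInverse_of_surjective hg
  -- Well-definedness of the shift: the rows |v| ≤ N of the shifted x are rows qv of x, of length at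
  -- most N+1, and these vanish.
  have hker : ∀ x, g x = 0 → g' x = 0 := by
    intro x hx
    have h1 := h.restrictRows_succ_eq_zero x.2 (congrArg Subtype.val hx)
    refine Subtype.ext (funext fun vi => ?_)
    have h2 := congrFun h1 (⟨q :: vi.1.1, by simpa using vi.1.2⟩, vi.2)
    exact h2
  have hT : ∀ x, g' (s (g x)) = g' x := by
    intro x
    have h1 : g (s (g x) - x) = 0 := by
      have := LinearMap.congr_fun hs (g x)
      rw [map_sub, sub_eq_zero]
      exact this
    have h2 := hker _ h1
    rwa [map_sub, sub_eq_zero] at h2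
  refine ⟨g' ∘ₗ s, fun w j => ?_⟩
  have h1 := hT ⟨_, col_mem_colSpan Φ f₀ w.2 j⟩
  refine Eq.trans h1 (Subtype.ext ?_)
  change restrictRows Q p N (shiftRows p q ((hankel Φ f₀).col (w.1, j))) = _
  rw [shiftRows_col]
  rfl

end Hankel

/-! ### Output of the algorithm -/

namespace Realization

variable {Q : Type*} {m p n N : ℕ} {Φ : Set (IOMap Q m p)} {f₀ : Φ}
  {iso : colSpace Φ f₀ N ≃ₗ[ℝ] (Fin n → ℝ)} {R : Realization Φ n}

theorem exists_isAlgorithmOutput [Finite Q] (h : RankCondition Φ f₀ N)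
    (iso : colSpace Φ f₀ N ≃ₗ[ℝ] (Fin n → ℝ)) :
    ∃ R : Realization Φ n, R.IsAlgorithmOutput f₀ N iso := by
  choose T hT using h.exists_shift
  let c : Q → colSpace Φ f₀ N →ₗ[ℝ] (Fin p → ℝ) := fun q =>
    (LinearMap.funLeft ℝ ℝ fun r => (⟨[], by simp⟩, (q, r))) ∘ₗ (colSpace Φ f₀ N).subtype
  refine ⟨⟨⟨fun q => LinearMap.toMatrix' (iso.toLinearMap ∘ₗ T q ∘ₗ iso.symm.toLinearMap),
    fun q => Matrix.of fun i z => iso (column Φ f₀ N ⟨[], by simp⟩ (Sum.inr (q, z))) i,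
    fun q => LinearMap.toMatrix' (c q ∘ₗ iso.symm.toLinearMap)⟩,
    fun f => iso (column Φ f₀ N ⟨[], by simp⟩ (Sum.inl f))⟩, ⟨?_, ?_, ?_, ?_⟩⟩
  · exact fun q z => rfl
  · intro q w j r
    rw [LinearMap.toMatrix'_mulVec]
    simp only [LinearMap.comp_apply, LinearEquiv.coe_coe, LinearEquiv.symm_apply_apply]
    rfl
  · intro q w j
    rw [LinearMap.toMatrix'_mulVec]
    simp only [LinearMap.comp_apply, LinearEquiv.coe_coe, LinearEquiv.symm_apply_apply]
    exact hT q w j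
  · exact fun f => rfl

/-- The initial states of a realization: `μ(f)` and the columns of the `B_q`. -/
def initial (R : Realization Φ n) : Φ ⊕ (Q × Fin m) → Fin n → ℝ
  | Sum.inl f => R.μ f
  | Sum.inr qz => (R.sys.B qz.1).col qz.2

namespace IsAlgorithmOutput

theorem initial_eq (h : R.IsAlgorithmOutput f₀ N iso) (j : Φ ⊕ (Q × Fin m)) :
    initial R j = iso (column Φ f₀ N ⟨[], by simp⟩ j) := by
  rcases j with f | ⟨q, z⟩
  · exact h.μ_eq f
  · exact h.B_eq q z

theorem C_apply (h : R.IsAlgorithmOutput f₀ N iso) (q : Q) (r : Fin p) (y : colSpace Φ f₀ N) :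
    (R.sys.C q *ᵥ iso y) r = y.1 (⟨[], by simp⟩, (q, r)) := by
  have : LinearMap.proj r ∘ₗ (R.sys.C q).mulVecLin ∘ₗ iso.toLinearMap =
      LinearMap.proj (R := ℝ) (φ := fun _ => ℝ) (⟨[], by simp⟩, (q, r)) ∘ₗ
        (colSpace Φ f₀ N).subtype :=
    colSpace_hom_ext fun w j => h.C_eq q w j r
  exact LinearMap.congr_fun this y

/-- The algorithm prescribes A_q on single columns only; linearity extends this to truncations of
arbitrary elements of `colSpan N`. -/
theorem A_apply (h : R.IsAlgorithmOutput f₀ N iso) (q : Q) {x : List Q × (Q × Fin p) → ℝ}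
    (hx : x ∈ colSpan Φ f₀ N) {y : colSpace Φ f₀ N} (hy : y.1 = restrictRows Q p N x) :
    (iso.symm (R.sys.A q *ᵥ iso y)).1 = restrictRows Q p N (shiftRows p q x) := by
  have hmem : ∀ x ∈ colSpan Φ f₀ N, restrictRows Q p N x ∈ colSpace Φ f₀ N := fun x hx =>
    restrictRows_mem_colSpace Φ f₀ (colSpan_mono Φ f₀ (Nat.le_succ N) hx)
  let D : colSpace Φ f₀ N →ₗ[ℝ] (WordLE Q N × (Q × Fin p) → ℝ) :=
    (colSpace Φ f₀ N).subtype ∘ₗ iso.symm.toLinearMap ∘ₗ (R.sys.A q).mulVecLin ∘ₗ iso.toLinearMap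
  change D y = _
  induction hx using Submodule.span_induction generalizing y with
  | mem x hx =>
    obtain ⟨⟨w, j⟩, rfl⟩ := hx
    have h1 := congrArg Subtype.val (h.A_eq q w j)
    rw [shiftRows_col]
    have h2 : y = column Φ f₀ N ⟨w.1, by have := w.2; omega⟩ j := Subtype.ext hy
    rw [h2]
    exact h1
  | zero =>
    have : y = 0 := Subtype.ext (by rw [hy, map_zero]; rfl)
    rw [this, map_zero, map_zero, map_zero]
  | add x x' hx hx' ih ih' =>
    have : y = ⟨_, hmem x hx⟩ + ⟨_, hmem x' hx'⟩ := Subtype.ext (by rw [hy, map_add]; rfl)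
    rw [this, map_add, map_add, map_add, ih rfl, ih' rfl]
  | smul a x hx ih =>
    have : y = a • ⟨_, hmem x hx⟩ := Subtype.ext (by rw [hy, map_smul]; rfl)
    rw [this, map_smul, map_smul, map_smul, ih rfl]

/-- Columns with |w| ≤ N already span the column space, so the prescribed values determine A_q. -/
theorem eq_of_rankCondition [Finite Q] (hr : RankCondition Φ f₀ N)
    (h : R.IsAlgorithmOutput f₀ N iso) {R' : Realization Φ n}
    (h' : R'.IsAlgorithmOutput f₀ N iso) : R' = R := by
  have hA : R'.sys.A = R.sys.A := by
    funext q
    refine Matrix.mulVec_injective (funext fun z => ?_)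
    obtain ⟨x, hx, hxy⟩ := hr.exists_eq (iso.symm z)
    have h1 := (h'.A_apply q hx hxy).trans (h.A_apply q hx hxy).symm
    simpa using iso.symm.injective (Subtype.ext h1)
  have hB : R'.sys.B = R.sys.B := by
    funext q
    ext i z
    exact congrFun ((h'.B_eq q z).trans (h.B_eq q z).symm) i
  have hC : R'.sys.C = R.sys.C := by
    funext q
    refine Matrix.mulVec_injective (funext fun z => ?_)
    funext r
    have h1 := (h'.C_apply q r (iso.symm z)).trans (h.C_apply q r (iso.symm z)).symm
    simpa using h1
  have hμ : R'.μ = R.μ := funext fun f => (h'.μ_eq f).trans (h.μ_eq f).symm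
  obtain ⟨⟨A, B, C⟩, μ⟩ := R
  obtain ⟨⟨A', B', C'⟩, μ'⟩ := R'
  simp only at hA hB hC hμ
  subst hA hB hC hμ
  rfl

theorem runWord_initial (h : R.IsAlgorithmOutput f₀ N iso) {w : List Q} (hw : w.length ≤ N + 1)
    (j : Φ ⊕ (Q × Fin m)) :
    R.sys.runWord w (initial R j) = iso (column Φ f₀ N ⟨w, hw⟩ j) := by
  induction w using List.reverseRecOn with
  | nil => exact h.initial_eq j
  | append_singleton w q ih =>
    have hw' : w.length ≤ N := by simpa using hw
    rw [LSS.runWord_append, ih (by omega), ← h.A_eq q ⟨w, hw'⟩ j, LinearEquiv.apply_symm_apply]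
    rfl

/-- The entries of a column are the outputs along the words of length at most `N`. -/
theorem entry_eq [Finite Q] (hr : RankCondition Φ f₀ N) (h : R.IsAlgorithmOutput f₀ N iso)
    {v : List Q} (hv : v.length ≤ N) (q : Q) (r : Fin p) (y : colSpace Φ f₀ N) :
    (R.sys.C q *ᵥ R.sys.runWord v (iso y)) r = y.1 (⟨v, hv⟩, (q, r)) := by
  induction v generalizing y with
  | nil => exact h.C_apply q r y
  | cons q' v ih =>
    obtain ⟨x, hx, hxy⟩ := hr.exists_eq y
    have h1 := ih (by simp at hv; omega) (iso.symm (R.sys.A q' *ᵥ iso y))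
    rw [LinearEquiv.apply_symm_apply, h.A_apply q' hx hxy] at h1
    rw [LSS.runWord_cons, h1, hxy]
    rfl

/-- The count is 2N+1 = (N+1) + N: the first N+1 letters lead to a column, the remaining ones select
a row. -/
theorem hankel_eq [Finite Q] (hr : RankCondition Φ f₀ N) (h : R.IsAlgorithmOutput f₀ N iso)
    {w : List Q} (hw : w.length ≤ 2 * N + 1) (q : Q) (r : Fin p) (j : Φ ⊕ (Q × Fin m)) :
    hankel Φ f₀ ([], (q, r)) (w, j) = (R.sys.C q *ᵥ R.sys.runWord w (initial R j)) r := by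
  have h1 : (w.take (N + 1)).length ≤ N + 1 := by simp
  have h2 : (w.drop (N + 1)).length ≤ N := by simp; omega
  conv_rhs => rw [← List.take_append_drop (N + 1) w, LSS.runWord_append, h.runWord_initial h1,
    h.entry_eq hr h2]
  change _ = hankel Φ f₀ (w.drop (N + 1), (q, r)) (w.take (N + 1), j)
  rcases j with f | qz <;> simp [hankel]

theorem isPartial [Finite Q] (hΦ : HasGeneralizedKernelRepresentation Φ)
    (hr : RankCondition Φ f₀ N) (h : R.IsAlgorithmOutput f₀ N iso) : R.IsPartial (2 * N + 1) := by
  intro f q w hw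
  refine ⟨fun q₀ j => funext fun r => ?_, funext fun r => ?_⟩
  · rw [hΦ.markovInput_eq f f₀]
    have h1 := h.hankel_eq hr hw q r (Sum.inr (q₀, j))
    simpa [hankel, initial] using h1
  · have h1 := h.hankel_eq hr hw q r (Sum.inl f)
    simpa [hankel, initial] using h1

/-- The entries of a column are Markov parameters of the output map of the corresponding state, so
the output map determines the state. -/
theorem observable [Finite Q] (hr : RankCondition Φ f₀ N) (h : R.IsAlgorithmOutput f₀ N iso) :
    R.Observable := by
  intro x₁ x₂ hx
  have hout : R.sys.output x₁ = R.sys.output x₂ := funext₂ hx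
  apply iso.symm.injective
  refine Subtype.ext (funext fun vi => ?_)
  obtain ⟨⟨v, hv⟩, q, r⟩ := vi
  rw [← h.entry_eq hr hv, ← h.entry_eq hr hv, LinearEquiv.apply_symm_apply,
    LinearEquiv.apply_symm_apply, ← LSS.markovState_output, ← LSS.markovState_output, hout]

end IsAlgorithmOutput

end Realization

/-! ### Semi-reachability -/

theorem mixedDeriv_zero {Q : Type*} {p : ℕ} (w : List Q) :
    mixedDeriv (fun _ : List (Q × ℝ≥0) => (0 : Fin p → ℝ)) w = 0 := by
  induction w with
  | nil => rfl
  | cons q w ih =>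
    simp only [mixedDeriv, ih]
    exact congrFun (derivWithin_const _ _) _

/-- A linear functional that vanishes on the reachable set vanishes on all `A_w μ(f)` and
`A_w B_q e_j`. -/
theorem Realization.functional_eq_zero {Q : Type*} [Nonempty Q] {m p n : ℕ}
    {Φ : Set (IOMap Q m p)} {f₀ : Φ} (R : Realization Φ n) {g : (Fin n → ℝ) →ₗ[ℝ] ℝ}
    (hg : ∀ x ∈ R.sys.Reach (range R.μ), g x = 0) (w : List Q) (j : Φ ⊕ (Q × Fin m)) :
    g (R.sys.runWord w (initial R j)) = 0 := by
  -- With g as output matrix in every mode, the states are unchanged and all outputs from the μ(f)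
  -- vanish.
  let S : LSS Q m 1 n := ⟨R.sys.A, R.sys.B, fun _ => LinearMap.toMatrix' (LinearMap.pi fun _ => g)⟩
  have hC : ∀ q x, S.C q *ᵥ x = fun _ => g x := fun q x => LinearMap.toMatrix'_mulVec _ _
  have hstate : ∀ (u : PC m) l τ x, S.stateFrom u τ x l = R.sys.stateFrom u τ x l := by
    intro u l
    induction l with
    | nil => intros; rfl
    | cons c l ih => intro τ x; exact ih _ _
  have hout : ∀ f, S.output (R.μ f) = fun _ _ => 0 := by
    intro f
    funext u v
    rw [LSS.output, hC, LSS.state, hstate]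
    funext i
    exact hg _ ⟨u, v, R.μ f, mem_range_self f, rfl⟩
  obtain ⟨q⟩ := ‹Nonempty Q›
  rcases j with f | ⟨q₀, z⟩
  · have h := S.markovState_output (R.μ f) q w
    rw [hout, hC] at h
    simp only [markovState, ioDeriv, mixedDeriv_zero] at h
    exact (congrFun h 0).symm
  · have h := S.markovInput_output (R.μ f₀) q q₀ z w
    rw [hout, hC] at h
    simp only [markovInput, ioDeriv, mixedDeriv_zero, sub_zero] at h
    exact (congrFun h 0).symm

theorem Realization.IsAlgorithmOutput.semiReachable {Q : Type*} {m p n N : ℕ}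
    {Φ : Set (IOMap Q m p)} {f₀ : Φ} {iso : colSpace Φ f₀ N ≃ₗ[ℝ] (Fin n → ℝ)}
    {R : Realization Φ n} (h : R.IsAlgorithmOutput f₀ N iso) : R.SemiReachable := by
  rcases isEmpty_or_nonempty Q with hQ | hQ
  -- Without modes there are no switching sequences, but there are no rows either, so the state
  -- space is zero.
  · refine Submodule.eq_top_iff'.2 fun x => ?_
    have hx : x = 0 := by
      apply iso.symm.injective
      exact Subtype.ext (funext fun vi => isEmptyElim vi.2.1)
    rw [hx]
    exact Submodule.zero_mem _
  · by_contra hne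
    obtain ⟨g, hg0, hg⟩ := Submodule.exists_le_ker_of_lt_top _ (lt_top_iff_ne_top.2 hne)
    have hz := R.functional_eq_zero (f₀ := f₀) (g := g)
      fun x hx => hg (Submodule.subset_span hx)
    have h1 : g ∘ₗ iso.toLinearMap = 0 := by
      refine colSpace_hom_ext fun w j => ?_
      have h2 := hz w.1 j
      rw [h.runWord_initial w.2 j] at h2
      exact h2
    refine hg0 (LinearMap.ext fun x => ?_)
    simpa using LinearMap.congr_fun h1 (iso.symm x)

/-! ### Full Hankel matrices -/

namespace Realization

variable {Q : Type*} {m p n : ℕ} {Φ : Set (IOMap Q m p)} {f₀ : Φ} {R : Realization Φ n}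

/-- All outputs `C_q A_v x` of a state. -/
def observations (S : LSS Q m p n) : (Fin n → ℝ) →ₗ[ℝ] (List Q × (Q × Fin p) → ℝ) :=
  LinearMap.pi fun vi =>
    LinearMap.proj vi.2.2 ∘ₗ (S.C vi.2.1).mulVecLin ∘ₗ S.runWordLin vi.1

theorem observations_apply (S : LSS Q m p n) (x : Fin n → ℝ) (v : List Q) (q : Q) (r : Fin p) :
    observations S x (v, (q, r)) = (S.C q *ᵥ S.runWord v x) r := by
  simp [observations]

theorem Realizes.output_eq (h : R.Realizes) (f : Φ) : f.1 = R.sys.output (R.μ f) :=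
  (funext₂ (h f)).symm

/-- The factorization of the Hankel matrix into an observability and a reachability map through ℝⁿ.
-/
theorem Realizes.col_eq (h : R.Realizes) (w : List Q) (j : Φ ⊕ (Q × Fin m)) :
    (hankel Φ f₀).col (w, j) =
      observations R.sys (R.sys.runWord w (initial R j)) := by
  funext ⟨v, q, r⟩
  rw [observations_apply, ← LSS.runWord_append]
  rcases j with f | ⟨q₀, z⟩
  · simp only [Matrix.col_apply, hankel, initial]
    rw [h.output_eq f, LSS.markovState_output]
  · simp only [Matrix.col_apply, hankel, initial]
    rw [h.output_eq f₀, LSS.markovInput_output]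

theorem Realizes.fullColSpan_le_range (h : R.Realizes) :
    fullColSpan Φ f₀ ≤ (observations R.sys).range := by
  refine Submodule.span_le.2 ?_
  rintro _ ⟨⟨w, j⟩, rfl⟩
  exact ⟨_, (h.col_eq w j).symm⟩

/-- The span of the states `A_w μ(f)`, `A_w B_q e_j` with `|w| < k`. -/
def reachSpan (R : Realization Φ n) (k : ℕ) : Submodule ℝ (Fin n → ℝ) :=
  Submodule.span ℝ {x | ∃ w j, w.length < k ∧
    x = R.sys.runWord w (initial R j)}

theorem reachSpan_mono (R : Realization Φ n) : Monotone R.reachSpan := by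
  intro k l hkl
  refine Submodule.span_mono ?_
  rintro x ⟨w, j, hw, rfl⟩
  exact ⟨w, j, hw.trans_le hkl, rfl⟩

/-- If V_k = V_{k+1}, then each A_q maps V_{k+1} into itself, so one more letter gives nothing new.
The convention |w| < k makes V_0 = 0, hence stability from k = n on. -/
theorem reachSpan_eq_of_le (R : Realization Φ n) {k l : ℕ} (hk : n ≤ k) (hl : k ≤ l) :
    R.reachSpan k = R.reachSpan l := by
  refine Submodule.eq_of_le_of_finrank_eq (R.reachSpan_mono hl) ?_
  refine eq_of_le_of_stable (d := fun k => Module.finrank ℝ (R.reachSpan k)) (n := n)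
    (fun k l h => Submodule.finrank_mono (R.reachSpan_mono h))
    (fun k => (Submodule.finrank_le _).trans (by simp)) (fun k h => ?_) hk hl
  have heq := Submodule.eq_of_le_of_finrank_eq (R.reachSpan_mono (Nat.le_succ k)) h
  have hA : ∀ q, R.reachSpan k ≤ (R.reachSpan (k + 1)).comap (R.sys.A q).mulVecLin := by
    intro q
    refine Submodule.span_le.2 ?_
    rintro _ ⟨w, j, hw, rfl⟩
    exact Submodule.subset_span ⟨w ++ [q], j, by simpa using hw, by
      rw [LSS.runWord_append]; rfl⟩
  have : R.reachSpan (k + 1) = R.reachSpan (k + 2) := by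
    refine le_antisymm (R.reachSpan_mono (Nat.le_succ _)) (Submodule.span_le.2 ?_)
    rintro _ ⟨w, j, hw, rfl⟩
    rcases List.eq_nil_or_concat w with rfl | ⟨w, q, rfl⟩
    · exact Submodule.subset_span ⟨[], j, by simp, rfl⟩
    · rw [List.concat_eq_append, LSS.runWord_append]
      refine hA q ?_
      rw [heq]
      exact Submodule.subset_span ⟨w, j, by simpa using hw, rfl⟩
  rw [this]

/-- The states whose outputs along words of length less than `k` vanish. -/
def unobservable (S : LSS Q m p n) (k : ℕ) : Submodule ℝ (Fin n → ℝ) :=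
  ⨅ (v : List Q) (_ : v.length < k) (q : Q), ((S.C q).mulVecLin ∘ₗ S.runWordLin v).ker

theorem mem_unobservable {S : LSS Q m p n} {k : ℕ} {x : Fin n → ℝ} :
    x ∈ unobservable S k ↔ ∀ v : List Q, v.length < k → ∀ q, S.C q *ᵥ S.runWord v x = 0 := by
  simp [unobservable, Submodule.mem_iInf]

theorem unobservable_antitone (S : LSS Q m p n) : Antitone (unobservable S) := by
  intro k l hkl x hx
  rw [mem_unobservable] at hx ⊢
  exact fun v hv => hx v (hv.trans_le hkl)

theorem unobservable_eq_of_le (S : LSS Q m p n) {k l : ℕ} (hk : n ≤ k) (hl : k ≤ l) :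
    unobservable S l = unobservable S k := by
  have hle : ∀ k, Module.finrank ℝ (unobservable S k) ≤ n := fun k =>
    (Submodule.finrank_le _).trans (by simp)
  refine Submodule.eq_of_le_of_finrank_eq (unobservable_antitone S hl) ?_
  -- Codimensions increase with k; the truncated subtraction is harmless because dimensions are at
  -- most n.
  have hd := eq_of_le_of_stable (d := fun k => n - Module.finrank ℝ (unobservable S k)) (n := n)
    (fun k l h => Nat.sub_le_sub_left (Submodule.finrank_mono (unobservable_antitone S h)) n)
    (fun k => Nat.sub_le _ _) (fun k h => ?_) hk hl
  · have h1 := hle k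
    have h2 := hle l
    omega
  · have heq : unobservable S (k + 1) = unobservable S k := by
      refine Submodule.eq_of_le_of_finrank_eq (unobservable_antitone S (Nat.le_succ k)) ?_
      have h1 := hle k
      have h2 := hle (k + 1)
      omega
    have : unobservable S (k + 2) = unobservable S (k + 1) := by
      refine le_antisymm (unobservable_antitone S (Nat.le_succ _)) fun x hx => ?_
      rw [mem_unobservable] at hx ⊢
      intro v hv q
      cases v with
      | nil => exact hx [] (by simp) q
      | cons q' v =>
        have hA : S.A q' *ᵥ x ∈ unobservable S (k + 1) := by
          rw [heq, mem_unobservable]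
          exact fun v hv q => hx (q' :: v) (by simpa using hv) q
        exact mem_unobservable.1 hA v (by simpa using hv) q
    rw [this]

theorem Realizes.colSpan_eq_fullColSpan (h : R.Realizes) {N : ℕ} (hn : n ≤ N + 1) :
    colSpan Φ f₀ N = fullColSpan Φ f₀ := by
  refine le_antisymm (colSpan_le_fullColSpan Φ f₀ N) (Submodule.span_le.2 ?_)
  rintro _ ⟨⟨w, j⟩, rfl⟩
  have hle : R.reachSpan (N + 1) ≤ (colSpan Φ f₀ N).comap (observations R.sys) := by
    refine Submodule.span_le.2 ?_
    rintro _ ⟨w, j, hw, rfl⟩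
    change observations R.sys _ ∈ colSpan Φ f₀ N
    rw [← h.col_eq]
    exact col_mem_colSpan Φ f₀ (by omega) j
  rw [h.col_eq]
  refine hle ?_
  rw [R.reachSpan_eq_of_le hn (le_max_left (N + 1) (w.length + 1))]
  exact Submodule.subset_span ⟨w, j, by simp, rfl⟩

theorem observations_eq_zero (S : LSS Q m p n) {N : ℕ} (hn : n ≤ N + 1) {x : Fin n → ℝ}
    (hx : restrictRows Q p N (observations S x) = 0) : observations S x = 0 := by
  have h1 : x ∈ unobservable S (N + 1) := by
    rw [mem_unobservable]
    intro v hv q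
    funext r
    rw [← observations_apply]
    exact congrFun hx (⟨v, by omega⟩, (q, r))
  funext ⟨v, q, r⟩
  rw [← unobservable_eq_of_le S hn (le_max_left (N + 1) (v.length + 1)), mem_unobservable] at h1
  rw [observations_apply, h1 v (by simp) q]
  rfl

theorem Realizes.eRank_eq [Finite Q] (h : R.Realizes) {N : ℕ} (hn : n ≤ N + 1) :
    (subHankel Φ f₀ N N).eRank = (hankel Φ f₀).eRank := by
  have hfin : FiniteDimensional ℝ (fullColSpan Φ f₀) :=
    Submodule.finiteDimensional_of_le (h.fullColSpan_le_range (f₀ := f₀))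
  have h1 : (hankel Φ f₀).eRank = (Module.finrank ℝ (fullColSpan Φ f₀) : ℕ∞) := by
    rw [Matrix.eRank, Matrix.cRank, ← fullColSpan, ← Module.finrank_eq_rank, Cardinal.toENat_nat]
  rw [eRank_subHankel, h.colSpan_eq_fullColSpan hn, h1]
  have hinj : Function.Injective ((restrictRows Q p N).domRestrict (fullColSpan Φ f₀)) := by
    rw [← LinearMap.ker_eq_bot, LinearMap.ker_eq_bot']
    rintro ⟨y, hy⟩ h0
    obtain ⟨x, rfl⟩ := h.fullColSpan_le_range hy
    exact Subtype.ext (observations_eq_zero R.sys hn h0)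
  have h2 := LinearMap.finrank_range_of_inj hinj
  rw [LinearMap.range_domRestrict] at h2
  rw [h2]

end Realization

/-! ### Consequences of rank H_{Φ,N,N} = rank H_Φ -/

section FullRank

variable {Q : Type*} [Finite Q] {m p N : ℕ} {Φ : Set (IOMap Q m p)} {f₀ : Φ}

/-- H_{Φ,N,N} has finitely many rows, so the equality forces rank H_Φ to be finite. -/
theorem rank_fullColSpan (h : (subHankel Φ f₀ N N).eRank = (hankel Φ f₀).eRank) :
    FiniteDimensional ℝ (fullColSpan Φ f₀) ∧ Module.finrank ℝ (fullColSpan Φ f₀) =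
      Module.finrank ℝ ((colSpan Φ f₀ N).map (restrictRows Q p N)) := by
  rw [eRank_subHankel, Matrix.eRank, Matrix.cRank, ← fullColSpan] at h
  have h1 := Cardinal.toENat_eq_natCast.1 h.symm
  exact ⟨Module.rank_lt_aleph0_iff.1 (h1 ▸ Cardinal.natCast_lt_aleph0),
    Module.finrank_eq_of_rank_eq h1⟩

theorem colSpan_eq_fullColSpan (h : (subHankel Φ f₀ N N).eRank = (hankel Φ f₀).eRank) :
    colSpan Φ f₀ N = fullColSpan Φ f₀ := by
  obtain ⟨hfin, hrank⟩ := rank_fullColSpan h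
  have hle := colSpan_le_fullColSpan Φ f₀ N
  have : FiniteDimensional ℝ (colSpan Φ f₀ N) := Submodule.finiteDimensional_of_le hle
  refine Submodule.eq_of_le_of_finrank_le hle ?_
  rw [hrank]
  exact Submodule.finrank_map_le _ _

/-- Both intermediate ranks lie between rank H_{Φ,N,N} and rank H_Φ. -/
theorem rankCondition_of_eRank_eq (h : (subHankel Φ f₀ N N).eRank = (hankel Φ f₀).eRank) :
    RankCondition Φ f₀ N := by
  obtain ⟨hfin, hrank⟩ := rank_fullColSpan h
  have hfin' : ∀ M, FiniteDimensional ℝ (colSpan Φ f₀ M) := fun M =>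
    Submodule.finiteDimensional_of_le (colSpan_le_fullColSpan Φ f₀ M)
  have hle : ∀ L M, Module.finrank ℝ ((colSpan Φ f₀ M).map (restrictRows Q p L)) ≤
      Module.finrank ℝ (fullColSpan Φ f₀) := fun L M =>
    (Submodule.finrank_map_le _ _).trans (Submodule.finrank_mono (colSpan_le_fullColSpan Φ f₀ M))
  have h1 : Module.finrank ℝ ((colSpan Φ f₀ N).map (restrictRows Q p (N + 1))) =
      Module.finrank ℝ (fullColSpan Φ f₀) := by
    refine le_antisymm (hle _ _) ?_
    obtain ⟨g, hg⟩ := exists_restrictRows_comp (Q := Q) p (Nat.le_succ N)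
    rw [hrank, ← hg, Submodule.map_comp]
    exact Submodule.finrank_map_le _ _
  have h2 : Module.finrank ℝ ((colSpan Φ f₀ (N + 1)).map (restrictRows Q p N)) =
      Module.finrank ℝ (fullColSpan Φ f₀) := by
    refine le_antisymm (hle _ _) ?_
    rw [hrank]
    exact Submodule.finrank_mono (Submodule.map_mono (colSpan_mono Φ f₀ (Nat.le_succ N)))
  rw [RankCondition, eRank_subHankel, eRank_subHankel, eRank_subHankel, h1, h2, hrank]
  exact ⟨rfl, rfl⟩

variable {n : ℕ} {iso : colSpace Φ f₀ N ≃ₗ[ℝ] (Fin n → ℝ)} {R : Realization Φ n}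

open Realization IsAlgorithmOutput

/-- Every column, for words of any length, lies in `colSpan N`, so A_q acts as the shift at each
letter. -/
theorem Realization.IsAlgorithmOutput.hankel_eq_of_eRank_eq
    (hr : (subHankel Φ f₀ N N).eRank = (hankel Φ f₀).eRank) (h : R.IsAlgorithmOutput f₀ N iso)
    (w : List Q) (q : Q) (r : Fin p) (j : Φ ⊕ (Q × Fin m)) :
    hankel Φ f₀ ([], (q, r)) (w, j) = (R.sys.C q *ᵥ R.sys.runWord w (initial R j)) r := by
  have hw : (iso.symm (R.sys.runWord w (initial R j))).1 =
      restrictRows Q p N ((hankel Φ f₀).col (w, j)) := by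
    induction w using List.reverseRecOn with
    | nil =>
      change (iso.symm (initial R j)).1 = _
      rw [h.initial_eq, LinearEquiv.symm_apply_apply]
      rfl
    | append_singleton w q ih =>
      have hx : (hankel Φ f₀).col (w, j) ∈ colSpan Φ f₀ N := by
        rw [colSpan_eq_fullColSpan hr]
        exact Submodule.subset_span (mem_range_self _)
      have h1 := h.A_apply q hx ih
      rw [LinearEquiv.apply_symm_apply, shiftRows_col] at h1
      rw [LSS.runWord_append, ← h1]
      rfl
  have h1 := h.C_apply q r (iso.symm (R.sys.runWord w (initial R j)))
  rw [LinearEquiv.apply_symm_apply, hw] at h1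
  exact h1.symm

theorem Realization.IsAlgorithmOutput.realizes (hΦ : HasGeneralizedKernelRepresentation Φ)
    (hr : (subHankel Φ f₀ N N).eRank = (hankel Φ f₀).eRank) (h : R.IsAlgorithmOutput f₀ N iso) :
    R.Realizes := by
  intro f u w
  obtain ⟨G, hG⟩ := hΦ.exists_isRepresentedBy
  obtain ⟨K, hK⟩ := hG f
  have hf : R.sys.output (R.μ f) = f.1 := by
    refine (R.sys.isRepresentedBy_output (R.μ f)).eq_of_markov_eq hK (fun q w => ?_)
      fun q q₀ j w => ?_
    · rw [LSS.markovState_output]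
      exact funext fun r => by
        simpa [hankel, initial] using (h.hankel_eq_of_eRank_eq hr w q r (Sum.inl f)).symm
    · rw [LSS.markovInput_output, hΦ.markovInput_eq f f₀]
      exact funext fun r => by
        simpa [hankel, initial] using (h.hankel_eq_of_eRank_eq hr w q r (Sum.inr (q₀, j))).symm
  rw [hf]

/-- The dimension n is the rank of a truncation of H_Φ, and every realization has dimension at least
rank H_Φ. -/
theorem Realization.IsAlgorithmOutput.isMinimal (hΦ : HasGeneralizedKernelRepresentation Φ)
    (hr : (subHankel Φ f₀ N N).eRank = (hankel Φ f₀).eRank) (h : R.IsAlgorithmOutput f₀ N iso) :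
    R.IsMinimal := by
  refine ⟨h.realizes hΦ hr, fun n' R' hR' => ?_⟩
  obtain ⟨hfin, -⟩ := rank_fullColSpan hr
  have : FiniteDimensional ℝ (colSpan Φ f₀ (N + 1)) :=
    Submodule.finiteDimensional_of_le (colSpan_le_fullColSpan Φ f₀ _)
  calc n = Module.finrank ℝ (Fin n → ℝ) := by simp
    _ = Module.finrank ℝ (colSpace Φ f₀ N) := iso.finrank_eq.symm
    _ = Module.finrank ℝ ((colSpan Φ f₀ (N + 1)).map (restrictRows Q p N)) := by rw [colSpace_eq]
    _ ≤ Module.finrank ℝ (colSpan Φ f₀ (N + 1)) := Submodule.finrank_map_le _ _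
    _ ≤ Module.finrank ℝ (fullColSpan Φ f₀) :=
      Submodule.finrank_mono (colSpan_le_fullColSpan Φ f₀ _)
    _ ≤ Module.finrank ℝ (observations R'.sys).range :=
      Submodule.finrank_mono (hR'.fullColSpan_le_range (f₀ := f₀))
    _ ≤ Module.finrank ℝ (Fin n' → ℝ) := LinearMap.finrank_range_le _
    _ = n' := by simp

end FullRank

end SwitchedSystem

end

open SwitchedSystem in
theorem theorem1 {Q : Type*} [Finite Q] {m p : ℕ} (Φ : Set (IOMap Q m p)) (f₀ : Φ)
    (hΦ : HasGeneralizedKernelRepresentation Φ) (N : ℕ) :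
    (RankCondition Φ f₀ N →
      ∃ n : ℕ, (subHankel Φ f₀ N (N + 1)).eRank = n ∧
        Nonempty (colSpace Φ f₀ N ≃ₗ[ℝ] (Fin n → ℝ)) ∧
        ∀ iso : colSpace Φ f₀ N ≃ₗ[ℝ] (Fin n → ℝ),
          ∃ R : Realization Φ n, R.IsAlgorithmOutput f₀ N iso ∧
            (∀ R' : Realization Φ n, R'.IsAlgorithmOutput f₀ N iso → R' = R) ∧
            R.SemiReachable ∧ R.Observable ∧ R.IsPartial (2 * N + 1)) ∧
    ((subHankel Φ f₀ N N).eRank = (hankel Φ f₀).eRank →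
      RankCondition Φ f₀ N ∧
        ∀ (n : ℕ) (iso : colSpace Φ f₀ N ≃ₗ[ℝ] (Fin n → ℝ)) (R : Realization Φ n),
          R.IsAlgorithmOutput f₀ N iso → R.IsMinimal) ∧
    ((∃ (n : ℕ) (R : Realization Φ n), R.Realizes ∧ n ≤ N + 1) →
      (subHankel Φ f₀ N N).eRank = (hankel Φ f₀).eRank) := by
  refine ⟨fun hr => ⟨Module.finrank ℝ (colSpace Φ f₀ N), ?_, ?_, fun iso => ?_⟩, fun hr =>
    ⟨rankCondition_of_eRank_eq hr, fun n iso R h => h.isMinimal hΦ hr⟩, ?_⟩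
  · rw [eRank_subHankel, colSpace_eq]
  · exact ⟨(Module.finBasis ℝ (colSpace Φ f₀ N)).equivFun⟩
  · obtain ⟨R, h⟩ := Realization.exists_isAlgorithmOutput hr iso
    exact ⟨R, h, fun R' h' => h.eq_of_rankCondition hr h', h.semiReachable, h.observable hr,
      h.isPartial hΦ hr⟩
  · rintro ⟨n, R, hR, hn⟩
    exact hR.eRank_eq hn
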